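/- Let $K$ be an algebraically closed field of characteristic zero. A connection over $K(\!(x)\!)$ is a finite-dimensional $K(\!(x)\!)$-vector space $V$ with a $K$-linear map $\nabla\colon V\to V$ such that $\nabla(av)=a\nabla(v)+\frac{da}{dx}v$ for $a\in K(\!(x)\!)$, $v\in V$; it is irreducible if $V\neq 0$ and $V$ has no $\nabla$-stable subspace other than $0$ and $V$. For connections $(V,\nabla)$ and $(W,\nabla')$, the space $\mathrm{Hom}_{K(\!(x)\!)}(V,W)$ carries the connection $\phi\mapsto \nabla'\circ\phi-\phi\circ\nabla$. For an integer $q\ge 1$ and $f\in K(\!(x^{1/q})\!)$ let $E_{f,q}$ be the connection $V=K(\!(x^{1/q})\!)$, regarded as a $K(\!(x)\!)$-vector space, with $\nabla(v)=\left(\frac{d}{dx}+x^{-1}f\right)v$. Let $J_m$ be $K(\!(x)\!)^m$ with the connection $\frac{d}{dx}+x^{-1}N_m$, where $N_m$ is the nilpotent Jordan block of size $m$. Every connection has a Hukuhara–Turrittin–Levelt decomposition $\bigoplus_i E_{f_i,q_i}\otimes J_{m_i}$, in which the class of each $f_i\in K(\!(x^{1/q_i})\!)$ modulo $x^{1/q_i}K[\![x^{1/q_i}]\!]+\frac1{q_i}\mathbb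 Z$ has no representative in $K(\!(x^{1/r})\!)$ with $0<r<q_i$. Its irregularity is \[ \mathrm{Irr}(V,\nabla)=\sum_i m_iq_i\max\bigl(0,-\mathrm{ord}_x f_i\bigr), \] with the convention that $f_i=0$ contributes $0$; this number does not depend on the decomposition. If $f\ne 0$ and $\mathrm{ord}_x f=-p/q$ with an integer $p\ge 0$, put \[ C_{f,q}(x,y)=\prod_{k=1}^{q}\left(y-\frac{1}{f(\zeta_q^k x^{1/q})}\right)\in K[\![x,y]\!], \] where $\zeta_q$ is a primitive $q$-th root of unity. For $F,G\in K[\![x,y]\!]$ let $I(F,G)=\dim_K K[\![x,y]\!]/\langle F,G\rangle$. Let $E_{f,q}=(V,\nabla)$ be irreducible, with $f\neq0$ and $\mathrm{ord}_x f=-p/q$, $p\ge 0$. (1) If $E_{g,q'}=(W,\nabla')$ is irreducible, with $g\ne0$ and $\mathrm{ord}_x g=-p'/q'$, $p'\ge 0$, and $E_{f,q}\not\cong E_{g,q'}$, then the irregularity of $\mathrm{Hom}_{K(\!(x)\!)}(V,W)$ is well defined, $I(C_{f,q},C_{g,q'})$ is finite, and \[ I(C_{f,q},C_{g,q'})=pq'+p'q-\mathrm{Irr}\bigl(\mathrm{Hom}_{K(\!(x)\!)}(V,W)\bigr).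 \] (2) The irregularity of $\mathrm{End}_{K(\!(x)\!)}(V)$ is well defined, $I\left(C_{f,q},\frac{\partial}{\partial y}C_{f,q}\right)$ is finite, and \[ I\left(C_{f,q},\tfrac{\partial}{\partial y}C_{f,q}\right)=2p(q-1)-\mathrm{Irr}\bigl(\mathrm{End}_{K(\!(x)\!)}(V)\bigr). \] -/

import Mathlib

noncomputable section

namespace FormalConnection

variable {K : Type*} [Field K]

/-! ### Laurent series in a root of `x`

`K((x))` is `LaurentSeries K`.  An element of `K((x^{1/q}))` is written as a Laurent series in the
variable `t = x^{1/q}`, so that the coefficient of index `n` is that of `x^{n/q}`. -/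

/-- The Euler operator `t d/dt` on `K((t))`. -/
def euler (a : LaurentSeries K) : LaurentSeries K where
  coeff n := (n : K) * a.coeff n
  isPWO_support' := a.isPWO_support.mono fun n hn h => hn (by
    show (n : K) * a.coeff n = 0
    rw [h, mul_zero])

@[simp]
theorem euler_coeff (a : LaurentSeries K) (n : ℤ) : (euler a).coeff n = (n : K) * a.coeff n := rfl

theorem euler_add (a b : LaurentSeries K) : euler (a + b) = euler a + euler b := by
  ext n
  simp [mul_add]

theorem euler_mul (a b : LaurentSeries K) : euler (a * b) = a * euler b + euler a * b := by
  ext n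
  have hb : (euler b).support ⊆ b.support := fun n hn h => hn (by
    show (n : K) * b.coeff n = 0
    rw [h, mul_zero])
  have ha : (euler a).support ⊆ a.support := fun n hn h => hn (by
    show (n : K) * a.coeff n = 0
    rw [h, mul_zero])
  rw [euler_coeff, HahnSeries.coeff_add, HahnSeries.coeff_mul,
    HahnSeries.coeff_mul_right' b.isPWO_support hb, HahnSeries.coeff_mul_left' a.isPWO_support ha,
    ← Finset.sum_add_distrib, Finset.mul_sum]
  refine Finset.sum_congr rfl fun ij hij => ?_
  rw [Finset.mem_antidiagonal] at hij
  rw [euler_coeff, euler_coeff, ← hij.2.2]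
  push_cast
  ring

theorem derivative_eq (a : LaurentSeries K) :
    LaurentSeries.derivative K a = HahnSeries.single (-1) 1 * euler a := by
  ext n
  have h := HahnSeries.coeff_single_mul_add (r := (1 : K)) (x := euler a) (a := n + 1) (b := -1)
  rw [show n + 1 + -1 = n by ring] at h
  rw [h]
  simp [LaurentSeries.derivative_apply]

/-- The embedding `K((x)) → K((t))`, `x ↦ t ^ q`. -/
def ramHom (K : Type*) [Field K] (q : ℕ+) : LaurentSeries K →+* LaurentSeries K :=
  HahnSeries.embDomainRingHom (AddMonoidHom.mulLeft ((q : ℕ) : ℤ))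
    (fun a b h => by
      have hq : ((q : ℕ) : ℤ) ≠ 0 := by exact_mod_cast q.ne_zero
      exact mul_left_cancel₀ hq h)
    (fun a b => by
      have hq : (0 : ℤ) < ((q : ℕ) : ℤ) := by exact_mod_cast q.pos
      exact mul_le_mul_iff_right₀ hq)

/-- The field `K((x^{1/q}))`, as a `K((x))`-vector space through `x = t ^ q`. -/
def Ram (K : Type*) [Field K] (_q : ℕ+) : Type _ := LaurentSeries K

instance (q : ℕ+) : Field (Ram K q) := inferInstanceAs (Field (LaurentSeries K))

instance (q : ℕ+) : Algebra (LaurentSeries K) (Ram K q) :=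
  RingHom.toAlgebra (S := Ram K q) (ramHom K q)

theorem ramHom_coeff_mul (q : ℕ+) (a : LaurentSeries K) (n : ℤ) :
    (ramHom K q a).coeff (((q : ℕ) : ℤ) * n) = a.coeff n :=
  HahnSeries.embDomain_coeff (a := n)

theorem ramHom_coeff_of_not_dvd (q : ℕ+) (a : LaurentSeries K) (n : ℤ)
    (h : ¬ ((q : ℕ) : ℤ) ∣ n) : (ramHom K q a).coeff n = 0 := by
  refine HahnSeries.embDomain_of_notMem_range ?_
  rintro ⟨m, hm⟩
  exact h ⟨m, hm.symm⟩

/-- The derivation `d/dx` of `K((x^{1/q}))`: since `x = t ^ q`, it is `q⁻¹ t ^ (-q) (t d/dt)`. -/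
def ddx (q : ℕ+) (v : LaurentSeries K) : LaurentSeries K :=
  HahnSeries.single (-((q : ℕ) : ℤ)) (((q : ℕ) : K)⁻¹) * euler v

theorem ddx_add (q : ℕ+) (v w : LaurentSeries K) : ddx q (v + w) = ddx q v + ddx q w := by
  simp [ddx, euler_add, mul_add]

theorem ddx_mul (q : ℕ+) (v w : LaurentSeries K) :
    ddx q (v * w) = v * ddx q w + ddx q v * w := by
  simp only [ddx, euler_mul]
  ring

/-- `ddx q` extends the usual `d/dx` of `K((x))`. -/
theorem ddx_ramHom [CharZero K] (q : ℕ+) (a : LaurentSeries K) :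
    ddx q (ramHom K q a) = ramHom K q (LaurentSeries.derivative K a) := by
  have hq : ((q : ℕ) : K) ≠ 0 := by exact_mod_cast q.ne_zero
  have h1 : euler (ramHom K q a) = HahnSeries.C ((q : ℕ) : K) * ramHom K q (euler a) := by
    ext n
    rw [HahnSeries.C_mul_eq_smul, HahnSeries.coeff_smul, euler_coeff]
    by_cases h : ((q : ℕ) : ℤ) ∣ n
    · obtain ⟨m, rfl⟩ := h
      rw [ramHom_coeff_mul, ramHom_coeff_mul, euler_coeff]
      push_cast
      simp only [smul_eq_mul]
      ring
    · rw [ramHom_coeff_of_not_dvd q _ n h, ramHom_coeff_of_not_dvd q _ n h]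
      simp
  have h2 : ramHom K q (HahnSeries.single (-1) 1) = HahnSeries.single (-((q : ℕ) : ℤ)) 1 := by
    refine (HahnSeries.embDomain_single).trans ?_
    simp
  rw [derivative_eq, map_mul, h2, ddx, h1, ← mul_assoc]
  congr 1
  rw [HahnSeries.C_apply, HahnSeries.single_mul_single, inv_mul_cancel₀ hq, add_zero]

/-! ### Connections -/

/-- A connection on a `K((x))`-vector space `V`: an additive map with the Leibniz rule.  It is
`K`-linear since constants have derivative zero (`Connection.map_const_smul`). -/
structure Connection (K V : Type*) [Field K] [AddCommGroup V] [Module (LaurentSeries K) V] where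
  /-- the underlying map -/
  nabla : V →+ V
  leibniz : ∀ (a : LaurentSeries K) (v : V),
    nabla (a • v) = a • nabla v + (LaurentSeries.derivative K a) • v

namespace Connection

variable {V W : Type*} [AddCommGroup V] [Module (LaurentSeries K) V]
  [AddCommGroup W] [Module (LaurentSeries K) W]

theorem map_const_smul (D : Connection K V) (c : K) (v : V) :
    D.nabla ((HahnSeries.C c : LaurentSeries K) • v) =
      (HahnSeries.C c : LaurentSeries K) • D.nabla v := by
  have h : LaurentSeries.derivative K (HahnSeries.C c : LaurentSeries K) = 0 := by
    rw [derivative_eq]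
    have : euler (HahnSeries.C c : LaurentSeries K) = 0 := by
      ext n
      rw [euler_coeff, HahnSeries.C_apply, HahnSeries.coeff_single]
      split_ifs with hn <;> simp [hn]
    rw [this, mul_zero]
  rw [D.leibniz, h, zero_smul, add_zero]

/-- Irreducibility: the only subspaces stable under the connection are the two trivial ones. -/
def IsIrreducible (D : Connection K V) : Prop :=
  Nontrivial V ∧ ∀ U : Submodule (LaurentSeries K) V, (∀ u ∈ U, D.nabla u ∈ U) → U = ⊥ ∨ U = ⊤

/-- Isomorphism of connections. -/
def Iso (D : Connection K V) (D' : Connection K W) : Prop :=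
  ∃ e : V ≃ₗ[LaurentSeries K] W, ∀ v, e (D.nabla v) = D'.nabla (e v)

/-- The connection `φ ↦ ∇' ∘ φ - φ ∘ ∇` on `Hom (V, W)`. -/
def hom (D : Connection K V) (D' : Connection K W) :
    Connection K (V →ₗ[LaurentSeries K] W) where
  nabla :=
    { toFun := fun φ =>
        { toFun := fun v => D'.nabla (φ v) - φ (D.nabla v)
          map_add' := fun v w => by
            simp only [map_add]
            abel
          map_smul' := fun a v => by
            simp only [map_smul, D.leibniz, D'.leibniz, map_add, RingHom.id_apply, smul_sub]
            abel }
      map_zero' := by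
        ext v
        simp
      map_add' := fun φ ψ => by
        ext v
        simp only [LinearMap.coe_mk, AddHom.coe_mk, LinearMap.add_apply, map_add]
        abel }
  leibniz a φ := by
    ext v
    simp only [AddMonoidHom.coe_mk, ZeroHom.coe_mk, LinearMap.coe_mk, AddHom.coe_mk,
      LinearMap.smul_apply, LinearMap.add_apply, D'.leibniz, smul_sub]
    abel

/-- The direct sum of finitely many connections. -/
def directSum {ι : Type*} [Fintype ι] {U : ι → Type*} [∀ i, AddCommGroup (U i)]
    [∀ i, Module (LaurentSeries K) (U i)] (D : ∀ i, Connection K (U i)) :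
    Connection K (∀ i, U i) where
  nabla :=
    { toFun := fun v i => (D i).nabla (v i)
      map_zero' := by
        ext i
        simp
      map_add' := fun v w => by
        ext i
        simp }
  leibniz a v := by
    ext i
    simp [(D i).leibniz]

/-- The tensor product `(V, ∇) ⊗ J_m`, where `J_m` is `K((x))^m` with `d/dx + x⁻¹ N`, `N` the
nilpotent Jordan block of size `m`.  The space is `V ⊗ K((x))^m = V^m`, and the connection is
`(v_i) ↦ (∇ v_i + x⁻¹ v_{i+1})` with `v_m = 0` (indices from `0` to `m - 1`). -/
def tensorJordan (D : Connection K V) (m : ℕ) : Connection K (Fin m → V) where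
  nabla :=
    { toFun := fun v i => D.nabla (v i) +
        if h : (i : ℕ) + 1 < m then (HahnSeries.single (-1) 1 : LaurentSeries K) • v ⟨i + 1, h⟩
        else 0
      map_zero' := by
        ext i
        simp
      map_add' := fun v w => by
        ext i
        simp only [Pi.add_apply, map_add, smul_add]
        split_ifs <;> abel }
  leibniz a v := by
    ext i
    simp only [AddMonoidHom.coe_mk, ZeroHom.coe_mk, Pi.smul_apply, Pi.add_apply, D.leibniz]
    split_ifs
    · rw [smul_add, smul_comm a]
      abel
    · simp

end Connection

/-- The operator `d/dx + x⁻¹ f` on `K((x^{1/q}))`, where `x⁻¹ = t ^ (-q)`. -/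
def elementaryOp (f : LaurentSeries K) (q : ℕ+) (v : LaurentSeries K) : LaurentSeries K :=
  ddx q v + HahnSeries.single (-((q : ℕ) : ℤ)) 1 * f * v

theorem elementaryOp_add (f : LaurentSeries K) (q : ℕ+) (v w : LaurentSeries K) :
    elementaryOp f q (v + w) = elementaryOp f q v + elementaryOp f q w := by
  simp only [elementaryOp, ddx_add]
  ring

theorem elementaryOp_leibniz [CharZero K] (f : LaurentSeries K) (q : ℕ+) (a v : LaurentSeries K) :
    elementaryOp f q (ramHom K q a * v) =
      ramHom K q a * elementaryOp f q v + ramHom K q (LaurentSeries.derivative K a) * v := by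
  simp only [elementaryOp, ddx_mul, ddx_ramHom]
  ring

/-- The connection `E_{f,q}`: the space `K((x^{1/q}))` with `∇ v = (d/dx + x⁻¹ f) v`. -/
def elementary [CharZero K] (f : LaurentSeries K) (q : ℕ+) : Connection K (Ram K q) where
  nabla := AddMonoidHom.mk' (M := Ram K q) (G := Ram K q) (elementaryOp f q) (elementaryOp_add f q)
  leibniz := elementaryOp_leibniz f q

/-! ### Irregularity -/

/-- `f` and `h` in `K((x^{1/q}))` are congruent modulo `x^{1/q} K[[x^{1/q}]] + (1/q) ℤ`. -/
def CongrMod (q : ℕ+) (f h : LaurentSeries K) : Prop :=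
  ∃ k : ℤ, ∀ n : ℤ, n ≤ 0 →
    (f - h).coeff n = (HahnSeries.C ((k : K) / ((q : ℕ) : K)) : LaurentSeries K).coeff n

/-- The class of `f ∈ K((x^{1/q}))` modulo `x^{1/q} K[[x^{1/q}]] + (1/q) ℤ` has no representative
in `K((x^{1/r}))` for any `0 < r < q`.  (A series in `t = x^{1/q}` lies in `K((x^{1/r}))` when
each exponent `n / q` that occurs is a multiple of `1 / r`.) -/
def HasExactRamification (f : LaurentSeries K) (q : ℕ+) : Prop :=
  ∀ r : ℕ, 0 < r → r < (q : ℕ) →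
    ¬ ∃ h : LaurentSeries K, CongrMod q f h ∧
      ∀ n : ℤ, h.coeff n ≠ 0 → ((q : ℕ) : ℤ) ∣ n * (r : ℤ)

variable {V : Type*} [AddCommGroup V] [Module (LaurentSeries K) V]

/-- `(V, ∇)` has a Hukuhara-Turrittin-Levelt decomposition `⨁ E_{f_i,q_i} ⊗ J_{m_i}` whose total
irregularity is `r`.  The summand `E_{f,q} ⊗ J_m` contributes its rank `m q` times the pole order
`max (0, - ord_x f)`, which is `m` times the pole order of `f` in the variable `x^{1/q}`. -/
def HasIrregularity [CharZero K] (D : Connection K V) (r : ℕ) : Prop :=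
  ∃ (n : ℕ) (f : Fin n → LaurentSeries K) (q m : Fin n → ℕ+),
    (∀ i, HasExactRamification (f i) (q i)) ∧
    D.Iso (Connection.directSum fun i => (elementary (f i) (q i)).tensorJordan (m i)) ∧
    r = ∑ i, (m i : ℕ) * (-(f i).order).toNat

/-- The irregularity of a connection (the unique `r` with `HasIrregularity D r`). -/
def irr [CharZero K] (D : Connection K V) : ℕ := sInf {r | HasIrregularity D r}

/-! ### Curve germs -/

/-- `f(c t)` for a Laurent series `f(t)`. -/
def twist (c : K) (f : LaurentSeries K) : LaurentSeries K where
  coeff n := c ^ n * f.coeff n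
  isPWO_support' := f.isPWO_support.mono fun n hn h => hn (by
    show c ^ n * f.coeff n = 0
    rw [h, mul_zero])

/-- The polynomial `∏ (y - 1 / f(ζ t))` over `K((t))`, `ζ` running over the `q`-th roots of
unity. -/
def curvePoly (f : LaurentSeries K) (q : ℕ+) : Polynomial (LaurentSeries K) :=
  ∏ ζ ∈ Polynomial.nthRootsFinset (q : ℕ) (1 : K),
    (Polynomial.X - Polynomial.C (twist ζ f)⁻¹)

/-- The curve `C_{f,q} ∈ K[[x, y]]`, with `x` the variable `0` and `y` the variable `1`.  When `f`
is nonzero of order at most `0`, the coefficients of `∏ (y - 1 / f(ζ t))` are power series in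
`t ^ q = x`, and `C_{f,q}` is obtained by reading off the coefficient of `t ^ (q a) y ^ b` as that
of `x ^ a y ^ b`. -/
def curve (f : LaurentSeries K) (q : ℕ+) : MvPowerSeries (Fin 2) K :=
  fun m => ((curvePoly f q).coeff (m 1)).coeff (((q : ℕ) : ℤ) * (m 0 : ℤ))

/-- The algebra `K[[x, y]] / (F, G)`. -/
abbrev IntersectionAlgebra (F G : MvPowerSeries (Fin 2) K) : Type _ :=
  MvPowerSeries (Fin 2) K ⧸ Ideal.span {F, G}

/-- The intersection number `dim_K K[[x, y]] / (F, G)`. -/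
def intersectionNumber (F G : MvPowerSeries (Fin 2) K) : ℕ :=
  Module.finrank K (IntersectionAlgebra F G)

end FormalConnection

end

noncomputable section

namespace FormalConnection

variable {K : Type*} [Field K]

open HahnSeries

/-! ### Orders, substitutions and twists of Laurent series -/

/-! Irregularity and intersection number are both sums of orders over pairs of conjugates of `f` and
`g`: of differences `u - v` for the first, of `1/u - 1/v` for the second. The identity `1/u - 1/v =
(v - u)/(uv)` translates one into the other, and the orders of `u` and `v` give the terms in `p` and
`p'`.

Irreducibility of `E_{f,q}` means that no `e > 1` divides `q` and all polar exponents of `f`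
(`IsIrreducible.polarlyPrimitive`): otherwise `f` is, up to gauge, a series in `t ^ e`, and sorting
exponents modulo `e` splits the connection. Hence distinct conjugates of `f` differ in their polar
parts, and for non-isomorphic connections the conjugates of `f` and `g` differ at some exponent at
most 0.

Connection side: write `q = b d`, `q' = a d` with `a`, `b` coprime. The tensor product of `K((t))`
and `K((u))` over `K((x))` is a product of `d` copies of `K((s))`, with `t = ζ^j s^a` and `u = s^b`.
Accordingly `Hom` is the sum over `j < d` of the elementary connections attached to `g(s^b) - f(ζ^j
s^a)` (`hom_iso_directSum`), and its irregularity is the sum of the pole orders of these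
differences. Irregularity is independent of the decomposition because it is the rate at which a
lattice grows under iteration of `x∇`, and any two lattices are commensurable
(`IsGrowthFiltration.le_of_iso`).

Curve side: if `g` has a pole, `C_{g,q'}` is a distinguished polynomial in `y`, parametrized by `u ↦
(u^{q'}, 1/g(u))`. The intersection number with another polynomial germ is the order of that
polynomial along the parametrization (`intersectionNumber_eq_order`), by Weierstrass division and
because `K[[x]][y]` has an image of finite codimension in `K[[u]]`. The order is then read off from
the factorization into conjugates. If `g` has no pole then `q' = 1` and the germ is a unit. -/

theorem order_eq_of_coeff {f : LaurentSeries K} {n : ℤ} (hn : f.coeff n ≠ 0)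
    (h : ∀ m < n, f.coeff m = 0) : f.order = n := by
  have hf : f ≠ 0 := by rintro rfl; simp at hn
  exact le_antisymm (order_le_of_coeff_ne_zero hn) ((le_order_iff_forall hf).2 h)

theorem coeff_single_mul_sub (n m : ℤ) (r : K) (f : LaurentSeries K) :
    (single n r * f).coeff m = r * f.coeff (m - n) := by
  have h := coeff_single_mul_add (r := r) (x := f) (a := m - n) (b := n)
  rwa [sub_add_cancel] at h

theorem ramHom_ramHom (a b : ℕ+) (f : LaurentSeries K) :
    ramHom K a (ramHom K b f) = ramHom K (a * b) f := by
  ext n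
  by_cases h : ((a : ℕ) : ℤ) ∣ n
  · obtain ⟨m, rfl⟩ := h
    rw [ramHom_coeff_mul]
    by_cases h' : ((b : ℕ) : ℤ) ∣ m
    · obtain ⟨k, rfl⟩ := h'
      rw [ramHom_coeff_mul, ← mul_assoc]
      have := ramHom_coeff_mul (a * b) f k
      push_cast at this
      exact this.symm
    · rw [ramHom_coeff_of_not_dvd _ _ _ h', ramHom_coeff_of_not_dvd]
      push_cast
      rwa [mul_dvd_mul_iff_left (by simp)]
  · rw [ramHom_coeff_of_not_dvd _ _ _ h, ramHom_coeff_of_not_dvd]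
    push_cast
    exact fun h' => h (dvd_of_mul_right_dvd h')

theorem ramHom_single (q : ℕ+) (n : ℤ) (c : K) :
    ramHom K q (single n c) = single (((q : ℕ) : ℤ) * n) c :=
  embDomain_single

theorem ramHom_C (q : ℕ+) (c : K) : ramHom K q (C c) = C c := by
  rw [C_apply, ramHom_single, mul_zero]

theorem ramHom_one_eq (f : LaurentSeries K) : ramHom K 1 f = f := by
  ext n
  simpa using ramHom_coeff_mul 1 f n

theorem order_ramHom (q : ℕ+) (f : LaurentSeries K) :
    (ramHom K q f).order = ((q : ℕ) : ℤ) * f.order := by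
  by_cases hf : f = 0
  · simp [hf]
  refine order_eq_of_coeff ?_ fun m hm => ?_
  · rw [ramHom_coeff_mul]
    exact fun h => hf (coeff_order_eq_zero.1 h)
  · by_cases h : ((q : ℕ) : ℤ) ∣ m
    · obtain ⟨k, rfl⟩ := h
      rw [ramHom_coeff_mul]
      exact coeff_eq_zero_of_lt_order (lt_of_mul_lt_mul_left hm (by positivity))
    · exact ramHom_coeff_of_not_dvd _ _ _ h

theorem euler_ramHom (q : ℕ+) (f : LaurentSeries K) :
    euler (ramHom K q f) = C ((q : ℕ) : K) * ramHom K q (euler f) := by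
  ext n
  rw [C_mul_eq_smul, coeff_smul, euler_coeff]
  by_cases h : ((q : ℕ) : ℤ) ∣ n
  · obtain ⟨m, rfl⟩ := h
    rw [ramHom_coeff_mul, ramHom_coeff_mul, euler_coeff]
    push_cast
    simp only [smul_eq_mul]
    ring
  · rw [ramHom_coeff_of_not_dvd q _ n h, ramHom_coeff_of_not_dvd q _ n h]
    simp

theorem euler_single (n : ℤ) (c : K) : euler (single n c) = single n ((n : K) * c) := by
  ext m
  rw [euler_coeff, coeff_single, coeff_single]
  split_ifs with h <;> simp [h]

theorem ddx_ramHom_mul [CharZero K] (e q : ℕ+) (f : LaurentSeries K) :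
    ddx (e * q) (ramHom K e f) = ramHom K e (ddx q f) := by
  have he : ((e : ℕ) : K) ≠ 0 := by exact_mod_cast e.ne_zero
  simp only [ddx, map_mul, euler_ramHom, ramHom_single, ← mul_assoc]
  congr 1
  rw [C_apply, single_mul_single, PNat.mul_coe, add_zero]
  push_cast
  rw [mul_neg, show (((e : ℕ) : K) * ((q : ℕ) : K))⁻¹ * ((e : ℕ) : K) = ((q : ℕ) : K)⁻¹ by
    field_simp]

@[simp]
theorem twist_coeff (c : K) (f : LaurentSeries K) (n : ℤ) :
    (twist c f).coeff n = c ^ n * f.coeff n := rfl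

theorem twist_mul {c : K} (hc : c ≠ 0) (f g : LaurentSeries K) :
    twist c (f * g) = twist c f * twist c g := by
  ext n
  have hf : (twist c f).support ⊆ f.support := fun n hn h => hn (by
    show c ^ n * f.coeff n = 0
    rw [h, mul_zero])
  have hg : (twist c g).support ⊆ g.support := fun n hn h => hn (by
    show c ^ n * g.coeff n = 0
    rw [h, mul_zero])
  have hf' : f.support ⊆ (twist c f).support := fun n hn h =>
    hn ((mul_eq_zero.1 h).resolve_left (zpow_ne_zero n hc))
  have hfs : (twist c f).support = f.support := Set.Subset.antisymm hf hf'
  rw [twist_coeff, coeff_mul, coeff_mul_right' g.isPWO_support hg, Finset.mul_sum]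
  refine Finset.sum_congr (by congr 1; exact hfs.symm) fun ij hij => ?_
  rw [Finset.mem_antidiagonal] at hij
  rw [twist_coeff, twist_coeff, ← hij.2.2, zpow_add₀ hc]
  ring

/-- The substitution `t ↦ c t` as a ring homomorphism. -/
def twistHom (c : Kˣ) : LaurentSeries K →+* LaurentSeries K where
  toFun := twist c
  map_one' := by
    ext n
    rw [twist_coeff, coeff_one]
    split_ifs with h <;> simp [h]
  map_mul' := twist_mul c.ne_zero
  map_zero' := by ext n; simp
  map_add' f g := by ext n; simp [mul_add]

theorem twistHom_apply (c : Kˣ) (f : LaurentSeries K) : twistHom c f = twist (c : K) f := rfl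

@[simp]
theorem twistHom_coeff (c : Kˣ) (f : LaurentSeries K) (n : ℤ) :
    (twistHom c f).coeff n = (c : K) ^ n * f.coeff n := rfl

theorem twistHom_one (f : LaurentSeries K) : twistHom 1 f = f := by
  ext n
  simp

theorem twistHom_twistHom (c d : Kˣ) (f : LaurentSeries K) :
    twistHom c (twistHom d f) = twistHom (c * d) f := by
  ext n
  simp [mul_zpow, mul_assoc]

theorem twistHom_single (c : Kˣ) (n : ℤ) (r : K) :
    twistHom c (single n r) = single n ((c : K) ^ n * r) := by
  ext m
  rw [twistHom_coeff, coeff_single, coeff_single]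
  split_ifs with h <;> simp [h]

theorem twistHom_ramHom (c : Kˣ) (q : ℕ+) (f : LaurentSeries K) :
    twistHom c (ramHom K q f) = ramHom K q (twistHom (c ^ (q : ℕ)) f) := by
  ext n
  rw [twistHom_coeff]
  by_cases h : ((q : ℕ) : ℤ) ∣ n
  · obtain ⟨m, rfl⟩ := h
    rw [ramHom_coeff_mul, ramHom_coeff_mul, twistHom_coeff, zpow_mul]
    simp
  · rw [ramHom_coeff_of_not_dvd q _ n h, ramHom_coeff_of_not_dvd q _ n h, mul_zero]

theorem euler_twistHom (c : Kˣ) (f : LaurentSeries K) :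
    euler (twistHom c f) = twistHom c (euler f) := by
  ext n
  simp only [euler_coeff, twistHom_coeff]
  ring

theorem order_twistHom (c : Kˣ) (f : LaurentSeries K) : (twistHom c f).order = f.order := by
  by_cases hf : f = 0
  · simp [hf]
  refine order_eq_of_coeff ?_ fun m hm => ?_
  · rw [twistHom_coeff]
    exact mul_ne_zero (zpow_ne_zero _ c.ne_zero) fun h => hf (coeff_order_eq_zero.1 h)
  · rw [twistHom_coeff, coeff_eq_zero_of_lt_order hm, mul_zero]

/-- The order of the pole of a Laurent series at the origin. -/
def pole (f : LaurentSeries K) : ℕ := (-f.order).toNat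

theorem pole_twistHom (c : Kˣ) (f : LaurentSeries K) : pole (twistHom c f) = pole f := by
  rw [pole, order_twistHom, pole]

theorem pole_ramHom (q : ℕ+) (f : LaurentSeries K) :
    pole (ramHom K q f) = (q : ℕ) * pole f := by
  rw [pole, order_ramHom, pole, ← mul_neg]
  rcases le_total 0 (-f.order) with h | h
  · lift -f.order to ℕ using h with k hk
    norm_cast
  · rw [Int.toNat_of_nonpos h, Int.toNat_of_nonpos, mul_zero]
    exact mul_nonpos_of_nonneg_of_nonpos (by positivity) h

theorem pole_eq_of_coeff {f g : LaurentSeries K} (h : ∀ n < 0, f.coeff n = g.coeff n) :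
    pole f = pole g := by
  suffices H : ∀ f g : LaurentSeries K, (∀ n < 0, f.coeff n = g.coeff n) → pole f ≤ pole g from
    le_antisymm (H f g h) (H g f fun n hn => (h n hn).symm)
  intro f g h
  rcases le_or_gt 0 f.order with h0 | h0
  · rw [pole, Int.toNat_of_nonpos (by omega)]
    exact Nat.zero_le _
  · have hf : f ≠ 0 := by rintro rfl; simp at h0
    have h1 : g.coeff f.order ≠ 0 := by
      rw [← h _ h0]
      exact fun h => hf (coeff_order_eq_zero.1 h)
    have := order_le_of_coeff_ne_zero h1
    unfold pole
    omega

/-! ### Splitting a Laurent series according to exponents modulo `e` -/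

/-- The part of `v` with exponents congruent to `k` modulo `e`, divided by `t ^ k` and
re-indexed. -/
def residuePart (e : ℕ+) (k : ℤ) (v : LaurentSeries K) : LaurentSeries K :=
  ofSuppBddBelow (fun n => v.coeff (((e : ℕ) : ℤ) * n + k)) (by
    have he : (0 : ℤ) < ((e : ℕ) : ℤ) := by exact_mod_cast e.pos
    refine ⟨-|v.order - k|, fun n hn => ?_⟩
    have h1 : v.order ≤ ((e : ℕ) : ℤ) * n + k := order_le_of_coeff_ne_zero hn
    by_contra hlt
    have h2 := neg_abs_le (v.order - k)
    have h3 := abs_nonneg (v.order - k)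
    nlinarith)

/-- The sum of `t ^ k w_k(t ^ e)` over `0 ≤ k < e`. -/
def assemble (e : ℕ+) (w : Fin e → LaurentSeries K) : LaurentSeries K :=
  ∑ k : Fin e, single ((k : ℕ) : ℤ) 1 * ramHom K e (w k)

theorem assemble_coeff (e : ℕ+) (w : Fin e → LaurentSeries K) (k : Fin e) (n : ℤ) :
    (assemble e w).coeff (((e : ℕ) : ℤ) * n + ((k : ℕ) : ℤ)) = (w k).coeff n := by
  rw [assemble, coeff_sum, Finset.sum_eq_single k]
  · rw [coeff_single_mul_sub, one_mul, add_sub_cancel_right, ramHom_coeff_mul]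
  · intro j _ hj
    rw [coeff_single_mul_sub, one_mul, ramHom_coeff_of_not_dvd]
    rw [add_sub_assoc, Int.dvd_add_right (dvd_mul_right _ _)]
    intro h
    have hk := k.isLt
    have hj' := j.isLt
    have := Int.eq_zero_of_abs_lt_dvd h (by rw [abs_lt]; omega)
    exact hj (Fin.ext (by omega))
  · simp

/-- Every exponent is `e n + k` for exactly one `n` and one `0 ≤ k < e`. -/
theorem assemble_bijective (e : ℕ+) :
    Function.Bijective (assemble e : (Fin e → LaurentSeries K) → LaurentSeries K) := by
  have he : (0 : ℤ) < ((e : ℕ) : ℤ) := by exact_mod_cast e.pos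
  constructor
  · intro w w' h
    funext k
    ext n
    rw [← assemble_coeff, h, assemble_coeff]
  · intro v
    refine ⟨fun k => residuePart e ((k : ℕ) : ℤ) v, ?_⟩
    ext n
    have h1 := Int.emod_nonneg n he.ne'
    have h2 := Int.emod_lt_of_pos n he
    have h3 : n = ((e : ℕ) : ℤ) * (n / ((e : ℕ) : ℤ)) +
        (((⟨(n % ((e : ℕ) : ℤ)).toNat, by omega⟩ : Fin e) : ℕ) : ℤ) := by
      simp only [Int.toNat_of_nonneg h1]
      rw [Int.mul_ediv_add_emod]
    rw [h3, assemble_coeff]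
    rfl

/-! ### Isomorphisms of connections -/

namespace Connection

variable {V W U : Type*} [AddCommGroup V] [Module (LaurentSeries K) V]
  [AddCommGroup W] [Module (LaurentSeries K) W] [AddCommGroup U] [Module (LaurentSeries K) U]

theorem Iso.symm {D : Connection K V} {D' : Connection K W} (h : D.Iso D') : D'.Iso D := by
  obtain ⟨e, he⟩ := h
  refine ⟨e.symm, fun w => ?_⟩
  rw [LinearEquiv.symm_apply_eq, he, e.apply_symm_apply]

theorem Iso.trans {D : Connection K V} {D' : Connection K W} {D'' : Connection K U}
    (h : D.Iso D') (h' : D'.Iso D'') : D.Iso D'' := by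
  obtain ⟨e, he⟩ := h
  obtain ⟨e', he'⟩ := h'
  exact ⟨e.trans e', fun v => by simp [he, he']⟩

theorem IsIrreducible.of_iso {D : Connection K V} {D' : Connection K W} (h : D.Iso D')
    (hD : D.IsIrreducible) : D'.IsIrreducible := by
  obtain ⟨e, he⟩ := h
  obtain ⟨hV, hU⟩ := hD
  refine ⟨e.symm.toEquiv.nontrivial, fun S hS => ?_⟩
  have h1 := hU (S.comap e.toLinearMap) fun u hu => by
    rw [Submodule.mem_comap, LinearEquiv.coe_coe] at hu ⊢
    rw [he]
    exact hS _ hu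
  refine h1.imp (fun h => ?_) (fun h => ?_)
  · rw [eq_bot_iff]
    intro w hw
    have : e.symm w ∈ S.comap e.toLinearMap := by simpa using hw
    rw [h, Submodule.mem_bot, LinearEquiv.symm_apply_eq, map_zero] at this
    simpa using this
  · rw [eq_top_iff]
    intro w _
    have : e.symm w ∈ S.comap e.toLinearMap := by rw [h]; trivial
    simpa using this

theorem directSum_apply {ι : Type*} [Fintype ι] {X : ι → Type*} [∀ i, AddCommGroup (X i)]
    [∀ i, Module (LaurentSeries K) (X i)] (D : ∀ i, Connection K (X i)) (v : ∀ i, X i) (i : ι) :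
    (directSum D).nabla v i = (D i).nabla (v i) := rfl

theorem directSum_congr {ι : Type*} [Fintype ι] {X Y : ι → Type*} [∀ i, AddCommGroup (X i)]
    [∀ i, Module (LaurentSeries K) (X i)] [∀ i, AddCommGroup (Y i)]
    [∀ i, Module (LaurentSeries K) (Y i)] {D : ∀ i, Connection K (X i)}
    {D' : ∀ i, Connection K (Y i)} (h : ∀ i, (D i).Iso (D' i)) :
    (directSum D).Iso (directSum D') := by
  choose e he using h
  refine ⟨LinearEquiv.piCongrRight e, fun v => ?_⟩
  funext i
  simp [directSum_apply, he]

theorem directSum_reindex {ι κ : Type*} [Fintype ι] [Fintype κ] (σ : κ ≃ ι) {X : ι → Type*}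
    [∀ i, AddCommGroup (X i)] [∀ i, Module (LaurentSeries K) (X i)]
    (D : ∀ i, Connection K (X i)) :
    (directSum D).Iso (directSum fun k => D (σ k)) :=
  ⟨(LinearEquiv.piCongrLeft (LaurentSeries K) X σ).symm, fun _ => rfl⟩

theorem directSum_sigma {ι : Type*} [Fintype ι] {κ : ι → Type*} [∀ i, Fintype (κ i)]
    {X : ∀ i, κ i → Type*} [∀ i k, AddCommGroup (X i k)]
    [∀ i k, Module (LaurentSeries K) (X i k)] (D : ∀ i k, Connection K (X i k)) :
    (directSum fun i => directSum (D i)).Iso (directSum fun p : Σ i, κ i => D p.1 p.2) :=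
  ⟨{ toFun := fun v p => v p.1 p.2
     invFun := fun v i k => v ⟨i, k⟩
     map_add' := fun _ _ => rfl
     map_smul' := fun _ _ => rfl
     left_inv := fun _ => rfl
     right_inv := fun _ => rfl }, fun _ => rfl⟩

theorem iso_tensorJordan_one (D : Connection K V) : D.Iso (D.tensorJordan 1) :=
  ⟨(LinearEquiv.funUnique (Fin 1) (LaurentSeries K) V).symm, fun v => by
    funext i
    simp [tensorJordan]⟩

/-- The kernel of the projection to the `i`-th summand is stable; it contains the `j`-th summand and
misses the `i`-th. -/
theorem not_isIrreducible_directSum {ι : Type*} [Fintype ι] {X : ι → Type*}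
    [∀ i, AddCommGroup (X i)] [∀ i, Module (LaurentSeries K) (X i)] [∀ i, Nontrivial (X i)]
    (D : ∀ i, Connection K (X i)) {i j : ι} (hij : i ≠ j) :
    ¬ (directSum D).IsIrreducible := by
  classical
  rintro ⟨-, h⟩
  obtain ⟨a, ha⟩ := exists_ne (0 : X i)
  obtain ⟨b, hb⟩ := exists_ne (0 : X j)
  rcases h (LinearMap.ker (LinearMap.proj (R := LaurentSeries K) (φ := X) i)) (fun u hu => by
    simp only [LinearMap.mem_ker, LinearMap.proj_apply] at hu ⊢
    rw [directSum_apply, hu, map_zero]) with h | h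
  · have : Pi.single j b ∈ LinearMap.ker (LinearMap.proj (R := LaurentSeries K) (φ := X) i) := by
      simp [hij]
    rw [h, Submodule.mem_bot] at this
    exact hb (by simpa using congrFun this j)
  · have : Pi.single i a ∈ LinearMap.ker (LinearMap.proj (R := LaurentSeries K) (φ := X) i) := by
      rw [h]; trivial
    simp at this
    exact ha this

end Connection

/-! ### Elementary connections -/

instance (q : ℕ+) : Nontrivial (Ram K q) := inferInstanceAs (Nontrivial (LaurentSeries K))

/-- Linearity over `K((x))` is phrased as commutation with multiplication by series in `t ^ q`, so
that applications are identities in the field `K((t))`. -/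
theorem elementary_iso [CharZero K] {f g : LaurentSeries K} {q : ℕ+}
    (φ : LaurentSeries K → LaurentSeries K) (hadd : ∀ v w, φ (v + w) = φ v + φ w)
    (hmul : ∀ a v, φ (ramHom K q a * v) = ramHom K q a * φ v) (hφ : Function.Bijective φ)
    (h : ∀ v, φ (elementaryOp f q v) = elementaryOp g q (φ v)) :
    (elementary f q).Iso (elementary g q) :=
  let ψ : Ram K q →ₗ[LaurentSeries K] Ram K q :=
    { toFun := φ
      map_add' := hadd
      map_smul' := hmul }
  ⟨LinearEquiv.ofBijective ψ hφ, h⟩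

theorem ofPowerSeries_coeff_of_neg (u : PowerSeries K) {n : ℤ} (hn : n < 0) :
    (ofPowerSeries ℤ K u).coeff n = 0 :=
  (PowerSeries.coeff_coe u n).trans (if_pos hn)

/-- The solution of `n u_n = ∑ c_{n-i} u_i` with `u_0 = 1`. -/
def eulerSolution (c : ℕ → K) : ℕ → K
  | 0 => 1
  | n + 1 => ((n + 1 : ℕ) : K)⁻¹ * ∑ i : Fin (n + 1), eulerSolution c i * c (n + 1 - i)
decreasing_by exact i.2

/-- The solution is the exponential of a primitive of `c dt/t`. Since `c` has no constant term,
comparing coefficients of `t ^ n` expresses `n u_n` through earlier coefficients, and `n` is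
invertible in characteristic zero. -/
theorem exists_euler_eq_mul [CharZero K] (c : LaurentSeries K) (hc : ∀ n ≤ 0, c.coeff n = 0) :
    ∃ u : LaurentSeries K, u ≠ 0 ∧ euler u = c * u := by
  set c' : PowerSeries K := PowerSeries.mk fun n => c.coeff n with hc'
  set u' : PowerSeries K := PowerSeries.mk (eulerSolution fun n => c.coeff n) with hu'
  have hcc : ofPowerSeries ℤ K c' = c := by
    ext n
    rcases lt_or_ge n 0 with h | h
    · rw [hc n h.le]
      exact ofPowerSeries_coeff_of_neg c' h
    · lift n to ℕ using h
      rw [ofPowerSeries_apply_coeff, hc', PowerSeries.coeff_mk]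
  refine ⟨ofPowerSeries ℤ K u', fun h => ?_, ?_⟩
  · have := congrArg (fun f => coeff f ((0 : ℕ) : ℤ)) h
    simp only [ofPowerSeries_apply_coeff, hu', PowerSeries.coeff_mk, coeff_zero] at this
    rw [eulerSolution] at this
    exact one_ne_zero this
  · rw [← hcc, ← map_mul]
    ext n
    rw [euler_coeff]
    rcases lt_or_ge n 0 with h | h
    · rw [ofPowerSeries_coeff_of_neg _ h, ofPowerSeries_coeff_of_neg _ h, mul_zero]
    · lift n to ℕ using h
      rw [ofPowerSeries_apply_coeff, ofPowerSeries_apply_coeff, mul_comm c', PowerSeries.coeff_mul,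
        hu', PowerSeries.coeff_mk]
      simp only [PowerSeries.coeff_mk, hc']
      cases n with
      | zero => simp [hc 0 le_rfl]
      | succ n =>
        have h0 : ((n + 1 : ℕ) : K) ≠ 0 := by exact_mod_cast n.succ_ne_zero
        rw [Finset.Nat.sum_antidiagonal_eq_sum_range_succ_mk, Finset.sum_range_succ]
        simp only [Nat.sub_self, Nat.cast_zero, hc 0 le_rfl, mul_zero, add_zero]
        rw [eulerSolution, Int.cast_natCast, mul_inv_cancel_left₀ h0, Finset.sum_range]

/-- Gauge transformation: multiplication by `u` replaces `f` by `f` minus the logarithmic derivative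
of `u` with respect to `x`, and any series with positive exponents only is such a derivative. -/
theorem iso_of_coeff_eq [CharZero K] {f g : LaurentSeries K} (q : ℕ+)
    (h : ∀ n ≤ 0, f.coeff n = g.coeff n) : (elementary f q).Iso (elementary g q) := by
  have hq : ((q : ℕ) : K) ≠ 0 := by exact_mod_cast q.ne_zero
  obtain ⟨u, hu, hu'⟩ := exists_euler_eq_mul (C ((q : ℕ) : K) * (f - g)) (fun n hn => by
    rw [C_mul_eq_smul, coeff_smul, coeff_sub, h n hn, sub_self, smul_zero])
  have hd : ddx q u = single (-((q : ℕ) : ℤ)) 1 * (f - g) * u := by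
    rw [ddx, hu', ← mul_assoc, ← mul_assoc, C_apply, single_mul_single, inv_mul_cancel₀ hq,
      add_zero]
  refine elementary_iso (u * ·) (mul_add u) (fun a v => mul_left_comm _ _ _)
    (Equiv.mulLeft₀ u hu).bijective fun v => ?_
  simp only [elementaryOp, ddx_mul, hd]
  ring

/-- The substitution `t ↦ c t` fixes `x = t ^ q`, so it is a `K((x))`-automorphism commuting with
`d/dx`. -/
theorem iso_twistHom [CharZero K] (f : LaurentSeries K) (q : ℕ+) (c : Kˣ)
    (hc : c ^ (q : ℕ) = 1) : (elementary f q).Iso (elementary (twistHom c f) q) := by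
  have hs : ∀ r : K, twistHom c (single (-((q : ℕ) : ℤ)) r) = single (-((q : ℕ) : ℤ)) r := by
    intro r
    have : (c : K) ^ (q : ℕ) = 1 := by rw [← Units.val_pow_eq_pow_val, hc, Units.val_one]
    rw [twistHom_single, zpow_neg, zpow_natCast, this, inv_one, one_mul]
  refine elementary_iso (twistHom c) (map_add _) (fun a v => ?_)
    (Function.bijective_iff_has_inverse.2 ⟨twistHom c⁻¹, fun v => ?_, fun v => ?_⟩) fun v => ?_
  · rw [map_mul, twistHom_ramHom, hc, twistHom_one]
  · rw [twistHom_twistHom, inv_mul_cancel, twistHom_one]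
  · rw [twistHom_twistHom, mul_inv_cancel, twistHom_one]
  · simp only [elementaryOp, ddx, map_add, map_mul, hs, euler_twistHom]

theorem assemble_add (e : ℕ+) (v w : Fin e → LaurentSeries K) :
    assemble e (v + w) = assemble e v + assemble e w := by
  simp [assemble, mul_add, Finset.sum_add_distrib]

theorem assemble_mul (e : ℕ+) (a : LaurentSeries K) (w : Fin e → LaurentSeries K) :
    assemble e (fun k => a * w k) = ramHom K e a * assemble e w := by
  simp only [assemble, map_mul, Finset.mul_sum]
  exact Finset.sum_congr rfl fun k _ => mul_left_comm _ _ _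

theorem elementaryOp_sum (f : LaurentSeries K) (q : ℕ+) {ι : Type*} (s : Finset ι)
    (v : ι → LaurentSeries K) :
    elementaryOp f q (∑ i ∈ s, v i) = ∑ i ∈ s, elementaryOp f q (v i) :=
  map_sum (AddMonoidHom.mk' (elementaryOp f q) (elementaryOp_add f q)) v s

/-- Differentiating the factor `t ^ k = x ^ (k / (e r))` produces the shift of `h` by the constant
`k / (e r)`. -/
theorem elementaryOp_single_mul_ramHom [CharZero K] (h : LaurentSeries K) (e r : ℕ+) (k : ℕ)
    (w : LaurentSeries K) :
    elementaryOp (ramHom K e h) (e * r) (single (k : ℤ) 1 * ramHom K e w) =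
      single (k : ℤ) 1 *
        ramHom K e (elementaryOp (h + C ((k : K) / ((e * r : ℕ+) : ℕ))) r w) := by
  have h1 : ddx (e * r) (single (k : ℤ) (1 : K)) =
      ramHom K e (single (-((r : ℕ) : ℤ)) 1 * C ((k : K) / ((e * r : ℕ+) : ℕ))) *
        single (k : ℤ) 1 := by
    rw [ddx, euler_single, (ramHom K e).map_mul, ramHom_C, ramHom_single, C_apply,
      single_mul_single, single_mul_single, single_mul_single, PNat.mul_coe]
    push_cast
    rw [mul_neg, add_zero, mul_one, mul_one, one_mul, div_eq_inv_mul]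
  have h2 : (single (-(((e * r : ℕ+) : ℕ) : ℤ)) 1 : LaurentSeries K) =
      ramHom K e (single (-((r : ℕ) : ℤ)) 1) := by
    rw [ramHom_single, PNat.mul_coe]
    push_cast
    rw [mul_neg]
  rw [elementaryOp, ddx_mul, ddx_ramHom_mul, h1, h2, elementaryOp]
  simp only [map_add, map_mul]
  ring

theorem elementaryOp_assemble [CharZero K] (h : LaurentSeries K) (e r : ℕ+)
    (w : Fin e → LaurentSeries K) :
    elementaryOp (ramHom K e h) (e * r) (assemble e w) = assemble e fun k =>
      elementaryOp (h + C (((k : ℕ) : K) / ((e * r : ℕ+) : ℕ))) r (w k) := by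
  rw [assemble, elementaryOp_sum, assemble]
  exact Finset.sum_congr rfl fun k _ => elementaryOp_single_mul_ramHom h e r k (w k)

/-- `E_{h(t^e), e r}` splits into `e` connections of ramification `r`. -/
theorem iso_directSum_ramHom [CharZero K] (h : LaurentSeries K) (e r : ℕ+) :
    (elementary (ramHom K e h) (e * r)).Iso (Connection.directSum fun k : Fin e =>
      elementary (h + C (((k : ℕ) : K) / ((e * r : ℕ+) : ℕ))) r) := by
  let φ : (Fin e → Ram K r) →ₗ[LaurentSeries K] Ram K (e * r) :=
    { toFun := fun w => (show LaurentSeries K from assemble e w)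
      map_add' := fun v w => assemble_add e v w
      map_smul' := fun a w => by
        refine (assemble_mul e (ramHom K r a) w).trans ?_
        rw [ramHom_ramHom]
        rfl }
  refine Connection.Iso.symm ⟨LinearEquiv.ofBijective φ (assemble_bijective e), fun w => ?_⟩
  exact (elementaryOp_assemble h e r w).symm

/-- The polar exponents of `f` generate, together with `q`, the unit ideal. -/
def PolarlyPrimitive (f : LaurentSeries K) (q : ℕ+) : Prop :=
  ∀ e : ℕ, 1 < e → e ∣ (q : ℕ) → ∃ n : ℤ, n < 0 ∧ f.coeff n ≠ 0 ∧ ¬ (e : ℤ) ∣ n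

/-- A change of representative affects only exponents at least 0, so all polar exponents survive. If
`q` divides `n r` for each of them, then `e = q / gcd(q, r)` divides them all, and `e > 1` when `r <
q`. -/
theorem PolarlyPrimitive.hasExactRamification {f : LaurentSeries K} {q : ℕ+}
    (h : PolarlyPrimitive f q) : HasExactRamification f q := by
  rintro r hr0 hr ⟨g, ⟨k, hk⟩, hg⟩
  have hq := q.pos
  have hd : 0 < Nat.gcd q r := Nat.gcd_pos_of_pos_left _ hq
  obtain ⟨e, he⟩ := Nat.gcd_dvd_left (q : ℕ) r
  obtain ⟨r', hr'⟩ := Nat.gcd_dvd_right (q : ℕ) r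
  have hcop : Nat.Coprime e r' := by
    have := Nat.coprime_div_gcd_div_gcd hd
    rwa [Nat.div_eq_of_eq_mul_right hd he, Nat.div_eq_of_eq_mul_right hd hr'] at this
  have he1 : 1 < e := by
    by_contra hle
    have hle : e ≤ 1 := by omega
    have h1 : Nat.gcd q r ≤ r := Nat.le_of_dvd hr0 (Nat.gcd_dvd_right _ _)
    have h2 : (q : ℕ) ≤ Nat.gcd q r := by
      conv_lhs => rw [he]
      exact (Nat.mul_le_mul_left _ hle).trans (by simp)
    omega
  obtain ⟨n, hn, hfn, hen⟩ := h e he1 ⟨_, he.trans (mul_comm _ _)⟩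
  have h1 := hk n hn.le
  rw [coeff_sub, C_apply, coeff_single_of_ne hn.ne, sub_eq_zero] at h1
  have h2 := hg n (h1 ▸ hfn)
  refine hen ?_
  have h3 : ((Nat.gcd q r : ℕ) : ℤ) * (e : ℤ) ∣ ((Nat.gcd q r : ℕ) : ℤ) * (n * (r' : ℤ)) := by
    have e1 : ((Nat.gcd q r : ℕ) : ℤ) * (e : ℤ) = ((q : ℕ) : ℤ) := by
      rw [← Nat.cast_mul, ← he]
    have e2 : ((Nat.gcd q r : ℕ) : ℤ) * (r' : ℤ) = (r : ℤ) := by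
      rw [← Nat.cast_mul, ← hr']
    rw [e1, mul_left_comm, e2]
    exact h2
  have h4 := (mul_dvd_mul_iff_left (by exact_mod_cast hd.ne')).1 h3
  exact (Nat.isCoprime_iff_coprime.2 hcop).dvd_of_dvd_mul_right h4

theorem ramHom_residuePart {e : ℕ+} {f : LaurentSeries K}
    (h : ∀ n, f.coeff n ≠ 0 → ((e : ℕ) : ℤ) ∣ n) : ramHom K e (residuePart e 0 f) = f := by
  ext n
  by_cases hn : ((e : ℕ) : ℤ) ∣ n
  · obtain ⟨m, rfl⟩ := hn
    rw [ramHom_coeff_mul]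
    change f.coeff (_ + 0) = _
    rw [add_zero]
  · rw [ramHom_coeff_of_not_dvd _ _ _ hn]
    by_contra hne
    exact hn (h n (Ne.symm hne))

theorem exists_ramHom_coeff_eq {e : ℕ+} {f : LaurentSeries K}
    (h : ∀ n < 0, f.coeff n ≠ 0 → ((e : ℕ) : ℤ) ∣ n) :
    ∃ g, ∀ n ≤ 0, f.coeff n = (ramHom K e g).coeff n := by
  refine ⟨residuePart e 0 (truncLT 1 f), fun n hn => ?_⟩
  rw [ramHom_residuePart, coeff_truncLT_of_lt (by omega)]
  intro n hn
  rcases lt_or_ge n 1 with h1 | h1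
  · rw [coeff_truncLT_of_lt h1] at hn
    rcases (show n < 0 ∨ n = 0 by omega) with h2 | rfl
    · exact h n h2 hn
    · exact dvd_zero _
  · rw [coeff_truncLT_of_le h1] at hn
    exact absurd rfl hn

/-- If `e > 1` divides `q = e r` and every polar exponent, then `f` agrees with some `g(t ^ e)` up
to exponent 0, and `E_{g(t^e), e r}` splits into `e ≥ 2` nonzero summands. -/
theorem IsIrreducible.polarlyPrimitive [CharZero K] {f : LaurentSeries K} {q : ℕ+}
    (h : (elementary f q).IsIrreducible) : PolarlyPrimitive f q := by
  intro e he hq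
  by_contra! hcon
  lift e to ℕ+ using by omega
  obtain ⟨r, hr⟩ := PNat.dvd_iff.2 hq
  subst hr
  obtain ⟨g, hg⟩ := exists_ramHom_coeff_eq hcon
  refine Connection.not_isIrreducible_directSum _ (i := ⟨0, by omega⟩) (j := ⟨1, he⟩) (by simp)
    (h.of_iso ((iso_of_coeff_eq _ hg).trans (iso_directSum_ramHom g e r)))

/-- `D` is a direct sum of elementary connections `E_{f,q}` with `f` primitive, with total pole
order `r`. -/
def HasElementaryDecomposition [CharZero K] {V : Type*} [AddCommGroup V]
    [Module (LaurentSeries K) V] (D : Connection K V) (r : ℕ) : Prop :=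
  ∃ (n : ℕ) (f : Fin n → LaurentSeries K) (q : Fin n → ℕ+),
    (∀ i, PolarlyPrimitive (f i) (q i)) ∧
    D.Iso (Connection.directSum fun i => elementary (f i) (q i)) ∧
    r = ∑ i, pole (f i)

/-! ### Decompositions into primitive elementary connections -/

section
variable [CharZero K] {V : Type*} [AddCommGroup V] [Module (LaurentSeries K) V]

theorem hasElementaryDecomposition_of_fintype {D : Connection K V} {ι : Type*} [Fintype ι]
    {f : ι → LaurentSeries K} {q : ι → ℕ+} (hf : ∀ i, PolarlyPrimitive (f i) (q i))
    (hD : D.Iso (Connection.directSum fun i => elementary (f i) (q i))) :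
    HasElementaryDecomposition D (∑ i, pole (f i)) := by
  let σ := (Fintype.equivFin ι).symm
  exact ⟨_, fun k => f (σ k), fun k => q (σ k), fun k => hf _,
    hD.trans (Connection.directSum_reindex σ _), (σ.sum_comp fun i => pole (f i)).symm⟩

theorem HasElementaryDecomposition.hasIrregularity {D : Connection K V} {r : ℕ}
    (h : HasElementaryDecomposition D r) : HasIrregularity D r := by
  obtain ⟨n, f, q, hf, hD, rfl⟩ := h
  exact ⟨n, f, q, fun _ => 1, fun i => (hf i).hasExactRamification,
    hD.trans (Connection.directSum_congr fun i => (elementary (f i) (q i)).iso_tensorJordan_one),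
    by simp [pole]⟩

theorem hasElementaryDecomposition_directSum {D : Connection K V} {ι : Type*} [Fintype ι]
    {X : ι → Type*} [∀ i, AddCommGroup (X i)] [∀ i, Module (LaurentSeries K) (X i)]
    {D' : ∀ i, Connection K (X i)} (hD : D.Iso (Connection.directSum D')) {r : ι → ℕ}
    (h : ∀ i, HasElementaryDecomposition (D' i) (r i)) :
    HasElementaryDecomposition D (∑ i, r i) := by
  choose n f q hf hD' hr using h
  have := hasElementaryDecomposition_of_fintype (ι := Σ i, Fin (n i))
    (f := fun p => f p.1 p.2) (q := fun p => q p.1 p.2) (fun p => hf p.1 p.2)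
    ((hD.trans (Connection.directSum_congr hD')).trans
      (Connection.directSum_sigma fun i k => elementary (f i k) (q i k)))
  rwa [Fintype.sum_sigma, ← Finset.sum_congr rfl fun i _ => hr i] at this

/-- Take the largest `e` dividing `q` and all polar exponents, and split off `f ~ g(t ^ e)` into `e`
pieces `g + const`. By maximality of `e` each piece is primitive. The total pole order is unchanged:
`f` has `e` times the pole order of `g`. -/
theorem hasElementaryDecomposition_elementary (f : LaurentSeries K) (q : ℕ+) :
    HasElementaryDecomposition (elementary f q) (pole f) := by
  classical
  let P : ℕ → Prop := fun e => e ∣ (q : ℕ) ∧ ∀ n < 0, f.coeff n ≠ 0 → (e : ℤ) ∣ n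
  have hP1 : P 1 := ⟨one_dvd _, fun n _ _ => by simp⟩
  have hle : ∀ e, P e → e ≤ q := fun e he => Nat.le_of_dvd q.pos he.1
  set e := Nat.findGreatest P q with he
  have hPe : P e := Nat.findGreatest_spec (hle 1 hP1) hP1
  have hmax : ∀ e', P e' → e' ≤ e := fun e' h' => Nat.le_findGreatest (hle e' h') h'
  have he0 : 0 < e := hmax 1 hP1
  clear_value e
  lift e to ℕ+ using he0
  obtain ⟨r, hr⟩ := PNat.dvd_iff.2 hPe.1
  subst hr
  obtain ⟨g, hg⟩ := exists_ramHom_coeff_eq hPe.2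
  have hgn : ∀ (c : K) (n : ℤ), n < 0 → (g + C c).coeff n = g.coeff n := fun c n hn => by
    rw [coeff_add, C_apply, coeff_single_of_ne hn.ne, add_zero]
  have hprim : ∀ c : K, PolarlyPrimitive (g + C c) r := by
    intro c e' he' hr'
    by_contra! hcon
    have : P (e * e') := by
      refine ⟨by rw [PNat.mul_coe]; exact mul_dvd_mul_left _ hr', fun n hn hfn => ?_⟩
      obtain ⟨m, rfl⟩ := hPe.2 n hn hfn
      rw [hg _ hn.le, ramHom_coeff_mul] at hfn
      push_cast
      have hm : m < 0 := by
        by_contra hm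
        have : (0 : ℤ) ≤ ((e : ℕ) : ℤ) * m := mul_nonneg (by positivity) (by omega)
        omega
      exact mul_dvd_mul_left _ (hcon m hm (by rwa [hgn c m hm]))
    have h1 := hmax _ this
    have := e.pos
    nlinarith
  have := hasElementaryDecomposition_of_fintype
    (f := fun k : Fin e => g + C (((k : ℕ) : K) / ((e * r : ℕ+) : ℕ))) (q := fun _ => r)
    (fun k => hprim _) ((iso_of_coeff_eq _ hg).trans (iso_directSum_ramHom g e r))
  convert this using 1
  rw [Finset.sum_congr rfl fun k _ => pole_eq_of_coeff (hgn _), Finset.sum_const,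
    pole_eq_of_coeff fun n hn => hg n hn.le, pole_ramHom]
  simp

end

/-! ### Decomposition of `Hom (E_{f,q}, E_{g,q'})` -/

/-- `K((t))` is free over `K((t^q))` with basis `1, t, …, t ^ (q - 1)`. -/
def ramEquiv (K : Type*) [Field K] (q : ℕ+) :
    (Fin q → LaurentSeries K) ≃ₗ[LaurentSeries K] Ram K q :=
  let φ : (Fin q → LaurentSeries K) →ₗ[LaurentSeries K] Ram K q :=
    { toFun := assemble q
      map_add' := assemble_add q
      map_smul' := assemble_mul q }
  LinearEquiv.ofBijective φ (assemble_bijective q)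

instance (q : ℕ+) : Module.Finite (LaurentSeries K) (Ram K q) :=
  Module.Finite.equiv (ramEquiv K q)

theorem finrank_ram (q : ℕ+) : Module.finrank (LaurentSeries K) (Ram K q) = q := by
  rw [← (ramEquiv K q).finrank_eq, Module.finrank_fin_fun]

/-- The substitution `t ↦ c s ^ a`. -/
def substHom (a : ℕ+) (c : Kˣ) : LaurentSeries K →+* LaurentSeries K :=
  (ramHom K a).comp (twistHom c)

theorem substHom_apply (a : ℕ+) (c : Kˣ) (v : LaurentSeries K) :
    substHom a c v = ramHom K a (twistHom c v) := rfl

theorem substHom_ramHom {a q : ℕ+} {c : Kˣ} (hc : c ^ (q : ℕ) = 1) (v : LaurentSeries K) :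
    substHom a c (ramHom K q v) = ramHom K (a * q) v := by
  rw [substHom_apply, twistHom_ramHom, hc, twistHom_one, ramHom_ramHom]

theorem twistHom_substHom (a : ℕ+) (c ω : Kˣ) (v : LaurentSeries K) :
    twistHom ω (substHom a c v) = substHom a (ω ^ (a : ℕ) * c) v := by
  rw [substHom_apply, twistHom_ramHom, twistHom_twistHom, substHom_apply]

theorem ddx_sum (q : ℕ+) {ι : Type*} (s : Finset ι) (v : ι → LaurentSeries K) :
    ddx q (∑ i ∈ s, v i) = ∑ i ∈ s, ddx q (v i) :=
  map_sum (AddMonoidHom.mk' (ddx q) (ddx_add q)) v s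

theorem ddx_single (q : ℕ+) (i : ℤ) :
    ddx q (single i (1 : K)) =
      ramHom K q (single (-1) ((i : K) / ((q : ℕ) : K))) * single i 1 := by
  rw [ddx, euler_single, ramHom_single, single_mul_single, single_mul_single]
  simp [div_eq_inv_mul]

/-- The coordinate of an additive map `ψ : K((t)) → K((u))` along the embedding `t ↦ c s ^ a`,
`u ↦ s ^ b`. -/
def homCoord (q a b : ℕ+) (c : Kˣ) (ψ : LaurentSeries K →+ LaurentSeries K) : LaurentSeries K :=
  ∑ i ∈ Finset.range q, ramHom K b (ψ (single (i : ℤ) 1)) * substHom a c (single (-(i : ℤ)) 1)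

theorem twistHom_homCoord {q a b : ℕ+} (c ω : Kˣ) (hω : ω ^ (b : ℕ) = 1)
    (ψ : LaurentSeries K →+ LaurentSeries K) :
    twistHom ω (homCoord q a b c ψ) = homCoord q a b (ω ^ (a : ℕ) * c) ψ := by
  simp only [homCoord, map_sum, map_mul, twistHom_substHom]
  refine Finset.sum_congr rfl fun i _ => ?_
  rw [twistHom_ramHom, hω, twistHom_one]

/-! ### Compatibility of the coordinates of `Hom` with multiplication and with `d/dx` -/

section
variable {q q' a b : ℕ+} {c : Kˣ} {ψ : LaurentSeries K →+ LaurentSeries K}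

/-- Up to the factor `1/q`, `t ^ (-i)` is the trace dual of `t ^ i`, so `homCoord` is a component of
`ψ` viewed in `K((t)) ⊗ K((u))`. Its summand is periodic in `i` of period `q`: the factors `x` and
`x⁻¹` that appear become inverse to each other in `K((s))`, where `x = s ^ (a q) = s ^ (b q')`. -/
theorem sum_homCoord_shift (hN : a * q = b * q') (hc : c ^ (q : ℕ) = 1)
    (hψ : ∀ x v, ψ (ramHom K q x * v) = ramHom K q' x * ψ v) (k : ℕ) :
    ∑ i ∈ Finset.range q, ramHom K b (ψ (single ((i + k : ℕ) : ℤ) 1)) *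
      substHom a c (single (-((i + k : ℕ) : ℤ)) 1) = homCoord q a b c ψ := by
  set A : ℕ → LaurentSeries K := fun i =>
    ramHom K b (ψ (single (i : ℤ) 1)) * substHom a c (single (-(i : ℤ)) 1) with hA
  have hper : ∀ i, A (i + q) = A i := by
    intro i
    have h1 : (single (((i + q : ℕ)) : ℤ) 1 : LaurentSeries K) =
        ramHom K q (single 1 1) * single (i : ℤ) 1 := by
      rw [ramHom_single, single_mul_single]
      push_cast
      rw [mul_one, mul_one, add_comm]
    have h2 : (single (-((i + q : ℕ) : ℤ)) 1 : LaurentSeries K) =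
        ramHom K q (single (-1) 1) * single (-(i : ℤ)) 1 := by
      rw [ramHom_single, single_mul_single]
      push_cast
      ring_nf
    have h3 : ramHom K (b * q') (single 1 1) * ramHom K (b * q') (single (-1) 1) = 1 := by
      rw [← map_mul, single_mul_single]
      simp
    simp only [hA]
    rw [h1, h2, hψ, map_mul, map_mul, ramHom_ramHom, substHom_ramHom hc, hN]
    linear_combination (ramHom K b (ψ (single (i : ℤ) 1)) *
      substHom a c (single (-(i : ℤ)) 1)) * h3
  change ∑ i ∈ Finset.range q, A (i + k) = ∑ i ∈ Finset.range q, A i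
  induction k with
  | zero => rfl
  | succ k ih =>
    have h1 := Finset.sum_range_succ (fun i => A (i + k)) q
    rw [Finset.sum_range_succ'] at h1
    have h2 : A ((q : ℕ) + k) = A (0 + k) := by
      rw [zero_add, add_comm, hper]
    rw [h2] at h1
    rw [← ih, ← add_right_cancel h1]
    exact Finset.sum_congr rfl fun i _ => by rw [add_assoc, add_comm 1 k]

/-- Precomposing `ψ` with multiplication by `v(t)` multiplies the coordinate by `v(c s^a)`. By
`K((x))`-linearity it suffices to treat `v = t ^ k`, which only shifts the summation index. -/
theorem sum_homCoord_mul (hN : a * q = b * q') (hc : c ^ (q : ℕ) = 1)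
    (hψ : ∀ x v, ψ (ramHom K q x * v) = ramHom K q' x * ψ v) (v : LaurentSeries K) :
    ∑ i ∈ Finset.range q, ramHom K b (ψ (single (i : ℤ) 1 * v)) *
      substHom a c (single (-(i : ℤ)) 1) = substHom a c v * homCoord q a b c ψ := by
  obtain ⟨w, rfl⟩ := (assemble_bijective q).2 v
  simp only [assemble, Finset.mul_sum, map_sum, Finset.sum_mul]
  rw [Finset.sum_comm]
  refine Finset.sum_congr rfl fun k _ => ?_
  rw [← sum_homCoord_shift hN hc hψ k, Finset.mul_sum]
  refine Finset.sum_congr rfl fun i _ => ?_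
  have h1 : single (i : ℤ) 1 * (single ((k : ℕ) : ℤ) 1 * ramHom K q (w k)) =
      ramHom K q (w k) * single ((i + k : ℕ) : ℤ) 1 := by
    rw [← mul_assoc, single_mul_single, mul_one, mul_comm]
    push_cast
    rfl
  have h2 : (single (-(i : ℤ)) 1 : LaurentSeries K) =
      single ((k : ℕ) : ℤ) 1 * single (-((i + k : ℕ) : ℤ)) 1 := by
    rw [single_mul_single]
    push_cast
    ring_nf
  rw [h1, h2, hψ, map_mul, map_mul, map_mul, ramHom_ramHom, substHom_ramHom hc, hN]
  ring

variable [CharZero K]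

theorem ramHom_elementaryOp (b q : ℕ+) (g w : LaurentSeries K) :
    ramHom K b (elementaryOp g q w) = elementaryOp (ramHom K b g) (b * q) (ramHom K b w) := by
  rw [elementaryOp, elementaryOp, map_add, map_mul, map_mul, ddx_ramHom_mul, ramHom_single]
  push_cast
  rw [mul_neg]

theorem ddx_substHom_single (hN : a * q = b * q') (i : ℤ) :
    ddx (b * q') (substHom a c (single (-i) 1)) =
      -(ramHom K (b * q') (single (-1) ((i : K) / ((q : ℕ) : K))) *
        substHom a c (single (-i) 1)) := by
  have ha : ((a : ℕ) : K) ≠ 0 := by exact_mod_cast a.ne_zero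
  rw [← hN, substHom_apply, ddx_ramHom_mul, ← ramHom_ramHom, ← map_mul, ← map_neg]
  congr 1
  rw [twistHom_single, ddx, euler_single, ramHom_single, single_mul_single, single_mul_single,
    ← single_neg]
  push_cast
  ring_nf

/-- Composition with `g` on the left becomes multiplication by `g(s^b)`, and with `f` on the right
multiplication by `f(c s^a)`. The derivative of `t ^ i` inside `ψ` matches the derivative of `t ^
(-i)` in the second factor. -/
theorem homCoord_horizontal (hN : a * q = b * q') (hc : c ^ (q : ℕ) = 1)
    (hψ : ∀ x v, ψ (ramHom K q x * v) = ramHom K q' x * ψ v) (f g : LaurentSeries K)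
    {θ : LaurentSeries K →+ LaurentSeries K}
    (hθ : ∀ v, θ v = elementaryOp g q' (ψ v) - ψ (elementaryOp f q v)) :
    homCoord q a b c θ =
      elementaryOp (ramHom K b g - substHom a c f) (b * q') (homCoord q a b c ψ) := by
  set X : LaurentSeries K := single (-(((b * q' : ℕ+) : ℕ) : ℤ)) 1 with hX
  have hX' : X = ramHom K (b * q') (single (-1) 1) := by
    rw [ramHom_single, mul_neg_one]
  have h1 : ∀ i : ℕ, ramHom K b (θ (single (i : ℤ) 1)) =
      ddx (b * q') (ramHom K b (ψ (single (i : ℤ) 1))) +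
        X * ramHom K b g * ramHom K b (ψ (single (i : ℤ) 1)) -
        ramHom K (b * q') (single (-1) ((i : K) / ((q : ℕ) : K))) *
          ramHom K b (ψ (single (i : ℤ) 1)) -
        X * ramHom K b (ψ (single (i : ℤ) 1 * f)) := by
    intro i
    have h2 : elementaryOp f q (single (i : ℤ) 1) =
        ramHom K q (single (-1) ((i : K) / ((q : ℕ) : K))) * single (i : ℤ) 1 +
          ramHom K q (single (-1) 1) * (single (i : ℤ) 1 * f) := by
      rw [elementaryOp, ddx_single, Int.cast_natCast, ramHom_single, ramHom_single, mul_neg_one]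
      ring
    rw [hθ, map_sub, ramHom_elementaryOp, h2, map_add, hψ, hψ, map_add, map_mul, map_mul,
      ramHom_ramHom, ramHom_ramHom, elementaryOp, ← hX, ← hX']
    ring
  have h3 := sum_homCoord_mul hN hc hψ f
  rw [elementaryOp, ← hX, mul_sub, sub_mul, mul_assoc X (substHom a c f), ← h3]
  simp only [homCoord, ddx_sum, Finset.mul_sum, ← Finset.sum_add_distrib,
    ← Finset.sum_sub_distrib]
  refine Finset.sum_congr rfl fun i _ => ?_
  rw [h1, ddx_mul, ddx_substHom_single hN, Int.cast_natCast]
  ring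

end

/-! The exponents: `q = b d` and `q' = a d` with `a`, `b` coprime. -/

/-- The substitution `s ↦ ω s` fixes `u = s ^ b` and carries the embedding `t = ζ^(k mod d) s^a` to
`t = ζ^k s^a`, so only `k` modulo `d` matters. With `u a + v b = 1` and `m = k / d`, the root is `ω
= ζ ^ (d u m)`. -/
theorem exists_unit_pow_eq {a b d : ℕ+} (hab : Nat.Coprime a b) {ζ : Kˣ}
    (hζ : ζ ^ ((b * d : ℕ+) : ℕ) = 1) (k : ℕ) :
    ∃ ω : Kˣ, ω ^ (b : ℕ) = 1 ∧ ω ^ (a : ℕ) * ζ ^ (k % (d : ℕ)) = ζ ^ k := by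
  obtain ⟨u, v, huv⟩ := Nat.isCoprime_iff_coprime.2 hab
  set m : ℕ := k / d with hm
  have hζ' : ∀ n : ℤ, ζ ^ (((b : ℕ) : ℤ) * ((d : ℕ) : ℤ) * n) = 1 := by
    intro n
    rw [zpow_mul, ← Nat.cast_mul, zpow_natCast, ← PNat.mul_coe, hζ, one_zpow]
  refine ⟨ζ ^ (((d : ℕ) : ℤ) * u * m), ?_, ?_⟩
  · rw [← zpow_natCast, ← zpow_mul, ← hζ' (u * m)]
    congr 1
    ring
  · rw [← zpow_natCast, ← zpow_natCast, ← zpow_mul, ← zpow_add, ← zpow_natCast,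
      ← mul_one (ζ ^ (_ : ℤ)), ← hζ' (v * m), ← zpow_add]
    congr 1
    have h1 : ((k : ℕ) : ℤ) = (k % (d : ℕ) : ℕ) + ((d : ℕ) : ℤ) * m := by
      rw [hm]
      exact_mod_cast (Nat.mod_add_div k d).symm
    rw [h1]
    linear_combination (((d : ℕ) : ℤ) * m) * huv

/-- Twisting turns the vanishing of `d` coordinates into that of all `q`. These are the values of
one linear form at the distinct nodes `ζ ^ (-k)`, so a Vandermonde argument kills every `ψ(t ^ i)`,
and the `t ^ i` form a basis. -/
theorem eq_zero_of_homCoord_eq_zero {q q' a b d : ℕ+} (hq : q = b * d)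
    (hab : Nat.Coprime a b) {ζ : Kˣ} (hζ : IsPrimitiveRoot ζ q)
    {ψ : LaurentSeries K →+ LaurentSeries K}
    (hψ : ∀ x v, ψ (ramHom K q x * v) = ramHom K q' x * ψ v)
    (h : ∀ j < (d : ℕ), homCoord q a b (ζ ^ j) ψ = 0) (v : LaurentSeries K) : ψ v = 0 := by
  have h1 : ∀ k, homCoord q a b (ζ ^ k) ψ = 0 := by
    intro k
    obtain ⟨ω, hω, hω'⟩ := exists_unit_pow_eq hab (hq ▸ hζ.pow_eq_one) k
    rw [← hω', ← twistHom_homCoord _ _ hω, h _ (Nat.mod_lt _ d.pos), map_zero]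
  have h2 := Matrix.eq_zero_of_forall_index_sum_pow_mul_eq_zero
    (f := fun k : Fin q => (C (((ζ ^ (k : ℕ))⁻¹ : Kˣ) : K) : LaurentSeries K))
    (v := fun i : Fin q => ramHom K b (ψ (single ((i : ℕ) : ℤ) 1)) *
      ramHom K a (single (-((i : ℕ) : ℤ)) 1)) (by
      intro k l hkl
      have h3 := Units.ext (C_injective hkl)
      exact Fin.ext (hζ.pow_inj k.2 l.2 (inv_injective h3))) (by
      intro k
      rw [← h1 k, homCoord, Finset.sum_range]
      refine Finset.sum_congr rfl fun i _ => ?_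
      rw [mul_left_comm]
      congr 1
      rw [← map_pow, substHom_apply, twistHom_single, ← ramHom_C a, ← map_mul, C_apply,
        single_mul_single, zero_add]
      congr 2
      simp [zpow_neg])
  obtain ⟨w, rfl⟩ := (assemble_bijective q).2 v
  rw [assemble, map_sum]
  refine Finset.sum_eq_zero fun k _ => ?_
  have h4 := congrFun h2 k
  simp only [Pi.zero_apply, mul_eq_zero, map_eq_zero, single_eq_zero_iff, one_ne_zero,
    or_false] at h4
  rw [mul_comm, hψ, h4, mul_zero]

/-- The index `d`-fold decomposition of `Hom (E_{f,q}, E_{g,q'})`. -/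
theorem hom_iso_directSum [CharZero K] {q q' a b d : ℕ+} (hq : q = b * d) (hq' : q' = a * d)
    (hab : Nat.Coprime a b) {ζ : Kˣ} (hζ : IsPrimitiveRoot ζ q) (f g : LaurentSeries K) :
    ((elementary f q).hom (elementary g q')).Iso (Connection.directSum fun j : Fin d =>
      elementary (ramHom K b g - substHom a (ζ ^ (j : ℕ)) f) (b * q')) := by
  have hN : a * q = b * q' := by rw [hq, hq', mul_left_comm]
  have hc : ∀ j : ℕ, (ζ ^ j) ^ (q : ℕ) = 1 := fun j => by
    rw [← pow_mul, mul_comm, pow_mul, hζ.pow_eq_one, one_pow]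
  let toAdd : (Ram K q →ₗ[LaurentSeries K] Ram K q') → (LaurentSeries K →+ LaurentSeries K) :=
    fun φ => φ.toAddMonoidHom
  have htoAdd : ∀ φ x v, toAdd φ (ramHom K q x * v) = ramHom K q' x * toAdd φ v :=
    fun φ x v => φ.map_smul x v
  let S : (Ram K q →ₗ[LaurentSeries K] Ram K q') →ₗ[LaurentSeries K]
      (Fin d → Ram K (b * q')) :=
    { toFun := fun φ j => homCoord q a b (ζ ^ (j : ℕ)) (toAdd φ)
      map_add' := fun φ φ' => by
        funext j
        change homCoord q a b (ζ ^ (j : ℕ)) (toAdd φ + toAdd φ') =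
          homCoord q a b (ζ ^ (j : ℕ)) (toAdd φ) + homCoord q a b (ζ ^ (j : ℕ)) (toAdd φ')
        simp only [homCoord, AddMonoidHom.add_apply, map_add, add_mul, Finset.sum_add_distrib]
      map_smul' := fun x φ => by
        funext j
        change homCoord q a b (ζ ^ (j : ℕ)) (toAdd (x • φ)) =
          ramHom K (b * q') x * homCoord q a b (ζ ^ (j : ℕ)) (toAdd φ)
        have h1 : ∀ v, toAdd (x • φ) v = ramHom K q' x * toAdd φ v := fun v => rfl
        simp only [homCoord, h1, map_mul, ramHom_ramHom, Finset.mul_sum, mul_assoc] }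
  have hS : Function.Injective S := by
    rw [← LinearMap.ker_eq_bot, LinearMap.ker_eq_bot']
    intro φ hφ
    refine LinearMap.ext fun v => eq_zero_of_homCoord_eq_zero hq hab hζ (htoAdd φ)
      (fun j hj => congrFun hφ ⟨j, hj⟩) v
  -- Both sides have dimension `q q' = d (b q')`, so injectivity suffices.
  have hfin : Module.finrank (LaurentSeries K) (Ram K q →ₗ[LaurentSeries K] Ram K q') =
      Module.finrank (LaurentSeries K) (Fin d → Ram K (b * q')) := by
    rw [Module.finrank_linearMap, Module.finrank_pi_fintype]
    simp only [finrank_ram, Finset.sum_const, Finset.card_univ, Fintype.card_fin, hq,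
      PNat.mul_coe, smul_eq_mul]
    ring
  refine ⟨LinearMap.linearEquivOfInjective S hS hfin, fun φ => ?_⟩
  funext j
  exact homCoord_horizontal hN (hc j) (htoAdd φ) f g (θ := toAdd _) fun v => rfl

theorem hasElementaryDecomposition_hom [CharZero K] {q q' a b d : ℕ+} (hq : q = b * d)
    (hq' : q' = a * d) (hab : Nat.Coprime a b) {ζ : Kˣ} (hζ : IsPrimitiveRoot ζ q)
    (f g : LaurentSeries K) :
    HasElementaryDecomposition ((elementary f q).hom (elementary g q'))
      (∑ j : Fin d, pole (ramHom K b g - substHom a (ζ ^ (j : ℕ)) f)) :=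
  hasElementaryDecomposition_directSum (hom_iso_directSum hq hq' hab hζ f g)
    fun _ => hasElementaryDecomposition_elementary _ _

theorem pole_sub_substHom_mod {a b d : ℕ+} (hab : Nat.Coprime a b) {ζ : Kˣ}
    (hζ : ζ ^ ((b * d : ℕ+) : ℕ) = 1) (f g : LaurentSeries K) (k : ℕ) :
    pole (ramHom K b g - substHom a (ζ ^ (k % (d : ℕ))) f) =
      pole (ramHom K b g - substHom a (ζ ^ k) f) := by
  obtain ⟨ω, hω, hω'⟩ := exists_unit_pow_eq hab hζ k
  rw [← pole_twistHom ω, map_sub, twistHom_substHom, hω', twistHom_ramHom, hω, twistHom_one]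

theorem sum_range_mul_of_mod (F : ℕ → ℕ) (b d : ℕ) (h : ∀ k, F (k % d) = F k) :
    ∑ k ∈ Finset.range (b * d), F k = b * ∑ k ∈ Finset.range d, F k := by
  induction b with
  | zero => simp
  | succ b ih =>
    rw [add_mul, one_mul, Finset.sum_range_add, ih, add_mul, one_mul]
    congr 1
    refine Finset.sum_congr rfl fun k _ => ?_
    rw [← h, Nat.mul_add_mod', h]

/-- The intersection number involves all `q` conjugates of `f`, the irregularity only `d` of them.
The pole order depends on `k` modulo `d`, so each value occurs `b` times. -/
theorem sum_pole_substHom {q a b d : ℕ+} (hq : q = b * d) (hab : Nat.Coprime a b) {ζ : Kˣ}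
    (hζ : IsPrimitiveRoot ζ q) (f g : LaurentSeries K) :
    ∑ k ∈ Finset.range q, pole (ramHom K b g - substHom a (ζ ^ k) f) =
      (b : ℕ) * ∑ j : Fin d, pole (ramHom K b g - substHom a (ζ ^ (j : ℕ)) f) := by
  rw [← Finset.sum_range fun j => pole (ramHom K b g - substHom a (ζ ^ j) f),
    ← sum_range_mul_of_mod _ b d, hq, PNat.mul_coe]
  exact pole_sub_substHom_mod hab (hq ▸ hζ.pow_eq_one) f g

/-! ### Lengths of subquotients -/

section Length
variable {V W : Type*} [AddCommGroup V] [Module K V] [AddCommGroup W] [Module K W]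

/-- The length of `B / (A ∩ B)`. -/
def quotLength (A B : Submodule K V) : ℕ∞ := Module.length K (B ⧸ A.submoduleOf B)

theorem quotLength_add {A B C : Submodule K V} (hAB : A ≤ B) (hBC : B ≤ C) :
    quotLength A C = quotLength A B + quotLength B C := by
  let i : (B ⧸ A.submoduleOf B) →ₗ[K] (C ⧸ A.submoduleOf C) :=
    Submodule.mapQ _ _ (Submodule.inclusion hBC) fun _ h => h
  let p : (C ⧸ A.submoduleOf C) →ₗ[K] (C ⧸ B.submoduleOf C) :=
    Submodule.mapQ _ _ LinearMap.id fun _ h => hAB h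
  refine Module.length_eq_add_of_exact i p ?_ ?_ ?_
  · rw [← LinearMap.ker_eq_bot, LinearMap.ker_eq_bot']
    intro y hy
    obtain ⟨y, rfl⟩ := Submodule.Quotient.mk_surjective _ y
    rw [Submodule.Quotient.mk_eq_zero]
    exact (Submodule.Quotient.mk_eq_zero (A.submoduleOf C) (x := Submodule.inclusion hBC y)).1 hy
  · intro y
    obtain ⟨y, rfl⟩ := Submodule.Quotient.mk_surjective _ y
    exact ⟨Submodule.Quotient.mk y, rfl⟩
  · intro y
    obtain ⟨y, rfl⟩ := Submodule.Quotient.mk_surjective _ y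
    refine (Submodule.Quotient.mk_eq_zero (B.submoduleOf C)).trans ⟨fun hy => ?_, ?_⟩
    · exact ⟨Submodule.Quotient.mk ⟨y, hy⟩, rfl⟩
    · rintro ⟨z, hz⟩
      obtain ⟨z, rfl⟩ := Submodule.Quotient.mk_surjective _ z
      have h1 : ((z : V) - (y : V)) ∈ B :=
        hAB ((Submodule.Quotient.eq (A.submoduleOf C) (x := Submodule.inclusion hBC z)).1 hz)
      have h2 := B.sub_mem z.2 h1
      rw [sub_sub_cancel] at h2
      exact h2

theorem quotLength_le_right {A B C : Submodule K V} (hAB : A ≤ B) (hBC : B ≤ C) :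
    quotLength A B ≤ quotLength A C := by
  rw [quotLength_add hAB hBC]
  exact le_self_add

theorem quotLength_le_left {A B C : Submodule K V} (hAB : A ≤ B) (hBC : B ≤ C) :
    quotLength B C ≤ quotLength A C := by
  rw [quotLength_add hAB hBC]
  exact le_add_self

theorem quotLength_map (A B : Submodule K V) {φ : V →ₗ[K] W} (hφ : Function.Injective φ) :
    quotLength (A.map φ) (B.map φ) = quotLength A B := by
  refine (LinearEquiv.length_eq (Submodule.Quotient.equiv _ _
    (B.equivMapOfInjective φ hφ) ?_)).symm
  ext ⟨w, hw⟩
  simp only [Submodule.mem_map]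
  constructor
  · rintro ⟨v, hv, hvw⟩
    exact ⟨v, hv, congrArg Subtype.val hvw⟩
  · rintro ⟨v, hv, hvw⟩
    obtain ⟨v', hv', hv''⟩ := hw
    obtain rfl := hφ (hv''.trans hvw.symm)
    exact ⟨⟨v', hv'⟩, hv, Subtype.ext hvw⟩

theorem quotLength_eq_card {ι : Type*} [Fintype ι] {A B : Submodule K V} (T : V →ₗ[K] (ι → K))
    (hA : ∀ v ∈ B, v ∈ A ↔ T v = 0) (hT : ∀ y, ∃ v ∈ B, T v = y) :
    quotLength A B = Fintype.card ι := by
  have h1 : A.submoduleOf B = LinearMap.ker (T.domRestrict B) := by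
    ext ⟨v, hv⟩
    exact hA v hv
  have h2 : Function.Surjective (T.domRestrict B) := fun y => by
    obtain ⟨v, hv, rfl⟩ := hT y
    exact ⟨⟨v, hv⟩, rfl⟩
  rw [quotLength, h1, (LinearMap.quotKerEquivOfSurjective _ h2).length_eq]
  simp

theorem quotLength_ne_top {ι : Type*} [Fintype ι] {A B : Submodule K V} (T : V →ₗ[K] (ι → K))
    (hA : ∀ v ∈ B, T v = 0 → v ∈ A) : quotLength A B ≠ ⊤ := by
  have h1 : LinearMap.ker (T.domRestrict B) ≤ A.submoduleOf B := fun v hv => hA v v.2 hv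
  have h2 : Module.length K (B ⧸ LinearMap.ker (T.domRestrict B)) ≤ Fintype.card ι := by
    rw [(LinearMap.quotKerEquivRange _).length_eq]
    refine (Module.length_le_of_injective (Submodule.subtype _)
      (Submodule.subtype_injective _)).trans ?_
    simp
  have h3 : quotLength A B ≤ Module.length K (B ⧸ LinearMap.ker (T.domRestrict B)) :=
    Module.length_le_of_surjective (Submodule.factor h1) (Submodule.factor_surjective h1)
  exact ne_top_of_le_ne_top (ENat.natCast_ne_top _) (h3.trans h2)

end Length

/-! ### Growth of lattices under iteration of `x ∇` -/

section Growth
variable {V W : Type*} [AddCommGroup V] [Module (LaurentSeries K) V] [AddCommGroup W]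
  [Module (LaurentSeries K) W]

/-- The operator `x ∇`. -/
def Connection.delta (D : Connection K V) (v : V) : V := (single 1 1 : LaurentSeries K) • D.nabla v

theorem Connection.delta_comm {D : Connection K V} {D' : Connection K W}
    {e : V ≃ₗ[LaurentSeries K] W} (he : ∀ v, e (D.nabla v) = D'.nabla (e v)) (v : V) :
    e (D.delta v) = D'.delta (e v) := by
  rw [delta, map_smul, he, delta]

variable [Module K V] [IsScalarTower K (LaurentSeries K) V] [Module K W]
  [IsScalarTower K (LaurentSeries K) W]

/-- Multiplication by `x ^ k`. -/
def xPow (K V : Type*) [Field K] [AddCommGroup V] [Module (LaurentSeries K) V] [Module K V]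
    [IsScalarTower K (LaurentSeries K) V] (k : ℕ) : V →ₗ[K] V :=
  (LinearMap.lsmul (LaurentSeries K) V (single (k : ℤ) 1)).restrictScalars K

theorem xPow_apply (k : ℕ) (v : V) : xPow K V k v = (single (k : ℤ) 1 : LaurentSeries K) • v := rfl

theorem xPow_add (k l : ℕ) (v : V) : xPow K V (k + l) v = xPow K V k (xPow K V l v) := by
  rw [xPow_apply, xPow_apply, xPow_apply, smul_smul, single_mul_single, mul_one, Nat.cast_add]

theorem xPow_injective (k : ℕ) : Function.Injective (xPow K V k) := by
  intro v w h
  exact smul_right_injective V (r := (single (k : ℤ) 1 : LaurentSeries K)) (by simp) h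

theorem Connection.delta_xPow (D : Connection K V) (k : ℕ) (v : V) :
    D.delta (xPow K V k v) = xPow K V k (D.delta v) + (k : K) • xPow K V k v := by
  rw [delta, xPow_apply, D.leibniz, delta, xPow_apply, smul_add, smul_comm, derivative_eq,
    euler_single, smul_smul (single 1 1), ← mul_assoc, single_mul_single, single_mul_single]
  congr 1
  rw [← smul_assoc, ← C_mul_eq_smul, C_apply, single_mul_single]
  simp

/-- A lattice `F 0` over `K[[x]]` such that `F (n + 1) = F n + x ∇ (F n)`, where `F n / F 0` has
length `r n`. -/
structure IsGrowthFiltration (D : Connection K V) (F : ℕ → Submodule K V) (r : ℕ) : Prop where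
  le_succ : ∀ n, F n ≤ F (n + 1)
  delta_mem : ∀ n, ∀ v ∈ F n, D.delta v ∈ F (n + 1)
  exists_add : ∀ n, ∀ v ∈ F (n + 1), ∃ u ∈ F n, ∃ w ∈ F n, v = u + D.delta w
  smul_mem : ∀ n, ∀ a : PowerSeries K, ∀ v ∈ F n, ofPowerSeries ℤ K a • v ∈ F n
  exhaustive : ∀ v, ∃ k, xPow K V k v ∈ F 0
  bounded : ∀ G : Submodule K V, (∀ a : PowerSeries K, ∀ v ∈ G, ofPowerSeries ℤ K a • v ∈ G) →
    (∀ v, ∃ k, xPow K V k v ∈ G) → ∃ k, ∀ v ∈ F 0, xPow K V k v ∈ G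
  quotLength_eq : ∀ n, quotLength (F 0) (F n) = (r * n : ℕ)
  quotLength_xPow : ∀ k, quotLength ((F 0).map (xPow K V k)) (F 0) ≠ ⊤

variable {D : Connection K V} {D' : Connection K W} {F : ℕ → Submodule K V}
  {F' : ℕ → Submodule K W} {r r' : ℕ}

/-- The exponent `k` can be chosen independently of `n`: from `x∇ ∘ x^k = x^k ∘ x∇ + k x^k`, the
inclusion at level `n` propagates to level `n + 1` with the same `k`. -/
theorem IsGrowthFiltration.exists_xPow_mem (hF : IsGrowthFiltration D F r)
    (hF' : IsGrowthFiltration D' F' r') {e : V ≃ₗ[LaurentSeries K] W}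
    (he : ∀ v, e (D.nabla v) = D'.nabla (e v)) :
    ∃ k, ∀ n, ∀ v ∈ F n, xPow K W k (e v) ∈ F' n := by
  let e' : V →ₗ[K] W := e.toLinearMap.restrictScalars K
  obtain ⟨k, hk⟩ := hF.bounded ((F' 0).comap e') (fun a v hv => by
      rw [Submodule.mem_comap] at hv ⊢
      have h1 := hF'.smul_mem 0 a _ hv
      rwa [show e' (ofPowerSeries ℤ K a • v) = ofPowerSeries ℤ K a • e' v from map_smul e _ _])
    (fun v => by
      obtain ⟨k, hk⟩ := hF'.exhaustive (e v)
      refine ⟨k, ?_⟩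
      rw [Submodule.mem_comap, xPow_apply]
      rw [xPow_apply] at hk
      rwa [show e' (_ • v) = _ • e v from map_smul e _ _])
  refine ⟨k, fun n => ?_⟩
  induction n with
  | zero =>
    intro v hv
    have h1 := hk v hv
    rw [Submodule.mem_comap, xPow_apply] at h1
    rw [xPow_apply, ← map_smul]
    exact h1
  | succ n ih =>
    intro v hv
    obtain ⟨u, hu, w, hw, rfl⟩ := hF.exists_add n v hv
    rw [map_add, map_add]
    refine add_mem (hF'.le_succ n (ih u hu)) ?_
    rw [Connection.delta_comm he]
    have h1 := D'.delta_xPow k (e w)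
    rw [eq_sub_of_add_eq h1.symm]
    exact sub_mem (hF'.delta_mem n _ (ih w hw))
      (Submodule.smul_mem _ _ (hF'.le_succ n (ih w hw)))

/-- A fixed power of `x` embeds every `F n` into `F' n`, and the image of `F 0` has finite colength
`c` in `F' 0`. Comparing lengths gives `r n ≤ c + r' n` for all `n`, which forces `r ≤ r'`. -/
theorem IsGrowthFiltration.le_of_iso (hF : IsGrowthFiltration D F r)
    (hF' : IsGrowthFiltration D' F' r') (h : D.Iso D') : r ≤ r' := by
  obtain ⟨e, he⟩ := h
  have he' : ∀ w, e.symm (D'.nabla w) = D.nabla (e.symm w) := fun w => by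
    rw [LinearEquiv.symm_apply_eq, he, e.apply_symm_apply]
  obtain ⟨k, hk⟩ := hF.exists_xPow_mem hF' he
  obtain ⟨l, hl⟩ := hF'.exists_xPow_mem hF he'
  let φ : V →ₗ[K] W := xPow K W k ∘ₗ e.toLinearMap.restrictScalars K
  have hφ : Function.Injective φ := (xPow_injective k).comp e.injective
  have hmap : ∀ n, (F n).map φ ≤ F' n := fun n => Submodule.map_le_iff_le_comap.2 (hk n)
  have hle : (F' 0).map (xPow K W (k + l)) ≤ (F 0).map φ := by
    rintro _ ⟨w, hw, rfl⟩
    refine ⟨xPow K V l (e.symm w), hl 0 w hw, ?_⟩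
    change xPow K W k (e (xPow K V l (e.symm w))) = _
    rw [xPow_add, xPow_apply l, map_smul, e.apply_symm_apply, xPow_apply l]
  have hmono : ∀ n, F 0 ≤ F n := fun n => monotone_nat_of_le_succ hF.le_succ n.zero_le
  have hmono' : ∀ n, F' 0 ≤ F' n := fun n => monotone_nat_of_le_succ hF'.le_succ n.zero_le
  have hfin : quotLength ((F 0).map φ) (F' 0) ≠ ⊤ :=
    ne_top_of_le_ne_top (hF'.quotLength_xPow (k + l)) (quotLength_le_left hle (hmap 0))
  obtain ⟨c, hc⟩ := ENat.ne_top_iff_exists.1 hfin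
  have key : ∀ n, r * n ≤ c + r' * n := by
    intro n
    have h1 := quotLength_le_right (Submodule.map_mono (f := φ) (hmono n)) (hmap n)
    rw [quotLength_map _ _ hφ, hF.quotLength_eq, quotLength_add (hmap 0) (hmono' n),
      hF'.quotLength_eq, ← hc] at h1
    exact_mod_cast h1
  by_contra hlt
  -- If `r ≥ r' + 1`, then `n = c + 1` would give `c + 1 ≤ c`.
  have h1 := key (c + 1)
  have h2 : (r' + 1) * (c + 1) ≤ r * (c + 1) := Nat.mul_le_mul_right _ (by omega)
  nlinarith

end Growth

/-! ### The growth filtration of a direct sum of `E_{f,q} ⊗ J_m` -/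

instance (q : ℕ+) : Module K (Ram K q) := inferInstanceAs (Module K (LaurentSeries K))

theorem ramHom_smul (q : ℕ+) (c : K) (a : LaurentSeries K) :
    ramHom K q (c • a) = c • ramHom K q a := by
  rw [← C_mul_eq_smul, map_mul, ramHom_C, C_mul_eq_smul]

theorem ramHom_smul_mul (q : ℕ+) (c : K) (a v : LaurentSeries K) :
    ramHom K q (c • a) * v = c • (ramHom K q a * v) := by
  rw [ramHom_smul, ← C_mul_eq_smul, ← C_mul_eq_smul, mul_assoc]

instance (q : ℕ+) : IsScalarTower K (LaurentSeries K) (Ram K q) :=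
  ⟨ramHom_smul_mul q⟩

/-- The Laurent series of order at least `n`. -/
def lattice (K : Type*) [Field K] (n : ℤ) : Submodule K (LaurentSeries K) where
  carrier := {v | ∀ k < n, v.coeff k = 0}
  add_mem' hv hw k hk := by rw [coeff_add, hv k hk, hw k hk, add_zero]
  zero_mem' _ _ := rfl
  smul_mem' c v hv k hk := by rw [coeff_smul, hv k hk, smul_zero]

theorem mem_lattice {n : ℤ} {v : LaurentSeries K} :
    v ∈ lattice K n ↔ ∀ k < n, v.coeff k = 0 := Iff.rfl

theorem mem_lattice_iff_orderTop {n : ℤ} {v : LaurentSeries K} :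
    v ∈ lattice K n ↔ (n : WithTop ℤ) ≤ v.orderTop := by
  rw [mem_lattice, le_orderTop_iff_forall]
  simp

theorem mem_lattice_order (v : LaurentSeries K) : v ∈ lattice K v.order :=
  fun _ hk => coeff_eq_zero_of_lt_order hk

theorem mem_lattice_neg_pole (v : LaurentSeries K) : v ∈ lattice K (-(pole v : ℤ)) :=
  fun _ hk => coeff_eq_zero_of_lt_order (by unfold pole at hk; omega)

theorem lattice_mono {m n : ℤ} (h : m ≤ n) : lattice K n ≤ lattice K m :=
  fun _ hv k hk => hv k (hk.trans_le h)

theorem mul_mem_lattice {m n : ℤ} {v w : LaurentSeries K} (hv : v ∈ lattice K m)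
    (hw : w ∈ lattice K n) : v * w ∈ lattice K (m + n) := by
  rw [mem_lattice_iff_orderTop] at *
  rw [orderTop_mul, WithTop.coe_add]
  exact add_le_add hv hw

theorem euler_mem_lattice {n : ℤ} {v : LaurentSeries K} (hv : v ∈ lattice K n) :
    euler v ∈ lattice K n := fun k hk => by rw [euler_coeff, hv k hk, mul_zero]

theorem single_mem_lattice (n : ℤ) (c : K) : single n c ∈ lattice K n :=
  fun _ hk => coeff_single_of_ne hk.ne

theorem ofPowerSeries_mem_lattice (a : PowerSeries K) : ofPowerSeries ℤ K a ∈ lattice K 0 :=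
  fun _ hk => ofPowerSeries_coeff_of_neg a hk

theorem exists_ofPowerSeries_eq {v : LaurentSeries K} (hv : v ∈ lattice K 0) :
    ∃ a, ofPowerSeries ℤ K a = v := by
  refine ⟨PowerSeries.mk fun n => v.coeff n, ?_⟩
  ext n
  rcases lt_or_ge n 0 with h | h
  · rw [hv n h, ofPowerSeries_coeff_of_neg _ h]
  · lift n to ℕ using h
    rw [ofPowerSeries_apply_coeff, PowerSeries.coeff_mk]

theorem ramHom_mem_lattice {q : ℕ+} {v : LaurentSeries K} (hv : v ∈ lattice K 0) :
    ramHom K q v ∈ lattice K 0 := by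
  intro k hk
  by_cases h : ((q : ℕ) : ℤ) ∣ k
  · obtain ⟨m, rfl⟩ := h
    rw [ramHom_coeff_mul]
    exact hv m (by
      by_contra hm
      have : (0 : ℤ) ≤ ((q : ℕ) : ℤ) * m := mul_nonneg (by positivity) (by omega)
      omega)
  · exact ramHom_coeff_of_not_dvd _ _ _ h

/-- The subspace of `K((x^{1/q}))` of series of order at least `n` in `x^{1/q}`. -/
def ramLattice (K : Type*) [Field K] (q : ℕ+) (n : ℤ) : Submodule K (Ram K q) := lattice K n

/-- The coefficient of `x^{k/q}`. -/
def ramCoeff (K : Type*) [Field K] (q : ℕ+) (k : ℤ) : Ram K q →ₗ[K] K :=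
  (HahnSeries.coeff.linearMap k : LaurentSeries K →ₗ[K] K)

theorem smul_mem_ramLattice {q : ℕ+} {n : ℤ} {v : Ram K q} (a : PowerSeries K)
    (hv : v ∈ ramLattice K q n) : ofPowerSeries ℤ K a • v ∈ ramLattice K q n := by
  have := mul_mem_lattice (ramHom_mem_lattice (q := q) (ofPowerSeries_mem_lattice a)) hv
  rw [zero_add] at this
  exact this

theorem ramCoeff_single_smul {q : ℕ+} (j k : ℤ) (v : Ram K q) :
    ramCoeff K q k ((single j 1 : LaurentSeries K) • v) =
      ramCoeff K q (k - ((q : ℕ) : ℤ) * j) v := by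
  have : ∀ v : LaurentSeries K, (ramHom K q (single j 1) * v).coeff k =
      v.coeff (k - ((q : ℕ) : ℤ) * j) := fun v => by
    rw [ramHom_single, coeff_single_mul_sub, one_mul]
  exact this v

theorem single_smul_elementaryOp (f : LaurentSeries K) (q : ℕ+) (v : LaurentSeries K) :
    ramHom K q (single 1 1) * elementaryOp f q v = ((q : ℕ) : K)⁻¹ • euler v + f * v := by
  rw [elementaryOp, mul_add, ddx, ramHom_single, ← mul_assoc, ← mul_assoc, ← mul_assoc,
    single_mul_single, single_mul_single, mul_one, add_neg_cancel, one_mul, mul_one,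
    ← C_mul_eq_smul, C_apply, single_zero_one, one_mul]

theorem exists_mem_lattice_sum {q : ℕ+} {v : LaurentSeries K} (hv : v ∈ lattice K 0) :
    ∃ a : Fin q → PowerSeries K,
      v = ∑ l : Fin q, ramHom K q (ofPowerSeries ℤ K (a l)) * single ((l : ℕ) : ℤ) 1 := by
  obtain ⟨w, rfl⟩ := (assemble_bijective q).2 v
  have hw : ∀ l, w l ∈ lattice K 0 := by
    intro l k hk
    rw [← assemble_coeff]
    have h1 := l.isLt
    refine hv _ ?_
    nlinarith
  choose a ha using fun l => exists_ofPowerSeries_eq (hw l)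
  refine ⟨a, Finset.sum_congr rfl fun l _ => ?_⟩
  rw [ha, mul_comm]

theorem order_inv_eq {f : LaurentSeries K} (hf : f ≠ 0) : f⁻¹.order = -f.order := by
  have := order_mul hf (inv_ne_zero hf)
  rw [mul_inv_cancel₀ hf, order_one] at this
  omega

/-- The vectors in `⨁ E_{f_i,q_i} ⊗ J_{m_i}` with components of pole order at most `N` times that
of `f_i`. -/
def growthLattice {n : ℕ} (f : Fin n → LaurentSeries K) (q m : Fin n → ℕ+) (N : ℕ) :
    Submodule K (∀ i, Fin (m i) → Ram K (q i)) :=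
  Submodule.pi Set.univ fun i => Submodule.pi Set.univ fun _ =>
    ramLattice K (q i) (-((pole (f i) * N : ℕ) : ℤ))

theorem mem_growthLattice {n : ℕ} {f : Fin n → LaurentSeries K} {q m : Fin n → ℕ+} {N : ℕ}
    {v : ∀ i, Fin (m i) → Ram K (q i)} :
    v ∈ growthLattice f q m N ↔
      ∀ i j, v i j ∈ ramLattice K (q i) (-((pole (f i) * N : ℕ) : ℤ)) := by
  simp [growthLattice, Submodule.mem_pi]

theorem xPow_mem_of_le {V : Type*} [AddCommGroup V] [Module (LaurentSeries K) V] [Module K V]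
    [IsScalarTower K (LaurentSeries K) V] {G : Submodule K V}
    (hG : ∀ a : PowerSeries K, ∀ v ∈ G, ofPowerSeries ℤ K a • v ∈ G) {k l : ℕ} (h : k ≤ l) {v : V}
    (hv : xPow K V k v ∈ G) : xPow K V l v ∈ G := by
  obtain ⟨c, rfl⟩ := Nat.exists_eq_add_of_le' h
  rw [xPow_add, xPow_apply]
  have := hG (PowerSeries.X ^ c) _ hv
  rwa [ofPowerSeries_X_pow] at this

/-! ### Finiteness and lengths for the growth lattices -/

section
variable {n : ℕ} {f : Fin n → LaurentSeries K} {q m : Fin n → ℕ+}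

/-- The lattice is generated over `K[[x]]` by `1, t, …, t ^ (q - 1)`, so a power of `x` that works
for these finitely many elements works throughout. -/
theorem ramLattice_bounded {q : ℕ+} (G : Submodule K (Ram K q))
    (hG : ∀ a : PowerSeries K, ∀ v ∈ G, ofPowerSeries ℤ K a • v ∈ G)
    (hG' : ∀ v, ∃ k, xPow K _ k v ∈ G) :
    ∃ k, ∀ v ∈ ramLattice K q 0, xPow K _ k v ∈ G := by
  let b : Fin q → Ram K q := fun l => (single ((l : ℕ) : ℤ) 1 : LaurentSeries K)
  choose k hk using fun l => hG' (b l)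
  refine ⟨∑ l, k l, fun v hv => ?_⟩
  obtain ⟨a, ha⟩ : ∃ a : Fin q → PowerSeries K, v = ∑ l, ofPowerSeries ℤ K (a l) • b l :=
    exists_mem_lattice_sum (v := v) hv
  rw [ha, map_sum]
  refine sum_mem fun l _ => ?_
  rw [xPow_apply, smul_comm, ← xPow_apply]
  exact hG _ _ (xPow_mem_of_le hG (Finset.single_le_sum (fun _ _ => Nat.zero_le _)
    (Finset.mem_univ l)) (hk l))

theorem growthLattice_bounded (G : Submodule K (∀ i, Fin (m i) → Ram K (q i)))
    (hG : ∀ a : PowerSeries K, ∀ v ∈ G, ofPowerSeries ℤ K a • v ∈ G)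
    (hG' : ∀ v, ∃ k, xPow K _ k v ∈ G) :
    ∃ k, ∀ v ∈ growthLattice f q m 0, xPow K _ k v ∈ G := by
  let Φ : ∀ i, Fin (m i) → Ram K (q i) →ₗ[LaurentSeries K] (∀ i, Fin (m i) → Ram K (q i)) :=
    fun i j => LinearMap.single (LaurentSeries K) (fun i => Fin (m i) → Ram K (q i)) i ∘ₗ
      LinearMap.single (LaurentSeries K) (fun _ => Ram K (q i)) j
  have hΦ : ∀ i j k v, Φ i j (xPow K _ k v) = xPow K _ k (Φ i j v) := fun i j k v =>
    map_smul (Φ i j) _ _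
  have h0 := fun (i : Fin n) (j : Fin (m i)) =>
    ramLattice_bounded (G.comap ((Φ i j).restrictScalars K))
      (fun a v hv => by
        rw [Submodule.mem_comap] at hv ⊢
        have := hG a _ hv
        rwa [LinearMap.restrictScalars_apply, ← map_smul] at this)
      (fun v => (hG' (Φ i j v)).imp fun k hk => by
        rw [Submodule.mem_comap, LinearMap.restrictScalars_apply, hΦ]
        exact hk)
  choose k hk using h0
  refine ⟨∑ i, ∑ j, k i j, fun v hv => ?_⟩
  have hsum : v = ∑ i, ∑ j, Φ i j (v i j) := by
    refine (Finset.univ_sum_single v).symm.trans (Finset.sum_congr rfl fun i _ => ?_)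
    conv_lhs => rw [← Finset.univ_sum_single (v i)]
    exact map_sum (LinearMap.single (LaurentSeries K) (fun i => Fin (m i) → Ram K (q i)) i) _ _
  rw [hsum, map_sum]
  refine sum_mem fun i _ => ?_
  rw [map_sum]
  refine sum_mem fun j _ => ?_
  have h1 := mem_growthLattice.1 hv i j
  rw [mul_zero, Nat.cast_zero, neg_zero] at h1
  have h2 := hk i j _ h1
  rw [Submodule.mem_comap, LinearMap.restrictScalars_apply, hΦ] at h2
  exact xPow_mem_of_le hG ((Finset.single_le_sum (f := fun j => k i j)
    (fun _ _ => Nat.zero_le _) (Finset.mem_univ j)).trans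
      (Finset.single_le_sum (f := fun i => ∑ j, k i j) (fun _ _ => Nat.zero_le _)
        (Finset.mem_univ i))) h2

theorem growthLattice_exhaustive (v : ∀ i, Fin (m i) → Ram K (q i)) :
    ∃ k, xPow K _ k v ∈ growthLattice f q m 0 := by
  set k : ℕ := ∑ i, ∑ j, pole (show LaurentSeries K from v i j) with hk
  refine ⟨k, mem_growthLattice.2 fun i j l hl => ?_⟩
  rw [mul_zero, Nat.cast_zero, neg_zero] at hl
  refine (ramCoeff_single_smul (k : ℤ) l (v i j)).trans ?_
  have h1 : pole (show LaurentSeries K from v i j) ≤ k :=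
    (Finset.single_le_sum (f := fun j => pole (show LaurentSeries K from v i j))
      (fun _ _ => Nat.zero_le _) (Finset.mem_univ j)).trans
      (Finset.single_le_sum (f := fun i => ∑ j, pole (show LaurentSeries K from v i j))
        (fun _ _ => Nat.zero_le _) (Finset.mem_univ i))
  refine mem_lattice_neg_pole (show LaurentSeries K from v i j) _ ?_
  have h2 : ((k : ℕ) : ℤ) ≤ (((q i : ℕ+) : ℕ) : ℤ) * k :=
    le_mul_of_one_le_left (by positivity) (by exact_mod_cast (q i).pos)
  omega

theorem quotLength_growthLattice (N : ℕ) :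
    quotLength (growthLattice f q m 0) (growthLattice f q m N) =
      ((∑ i, (m i : ℕ) * pole (f i)) * N : ℕ) := by
  -- The index `l` stands for the exponent `-l - 1`, so `ι` lists the polar coefficients available
  -- at level `N`.
  let ι := Σ i, Fin (m i) × Fin (pole (f i) * N)
  let T : (∀ i, Fin (m i) → Ram K (q i)) →ₗ[K] (ι → K) :=
    LinearMap.pi fun p => ramCoeff K (q p.1) (-((p.2.2 : ℕ) : ℤ) - 1) ∘ₗ LinearMap.proj p.2.1 ∘ₗ
      LinearMap.proj p.1
  have hT : ∀ v p, T v p = ramCoeff K (q p.1) (-((p.2.2 : ℕ) : ℤ) - 1) (v p.1 p.2.1) :=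
    fun v p => rfl
  rw [quotLength_eq_card T]
  · congr 1
    simp only [ι, Fintype.card_sigma, Fintype.card_prod, Fintype.card_fin, Finset.sum_mul]
    exact Finset.sum_congr rfl fun i _ => (mul_assoc _ _ _).symm
  · intro v hv
    rw [mem_growthLattice]
    rw [mem_growthLattice] at hv
    constructor
    · intro h
      funext p
      rw [hT]
      exact h p.1 p.2.1 _ (by simp; omega)
    · intro h i j k hk
      by_cases hk' : k < -((pole (f i) * N : ℕ) : ℤ)
      · exact hv i j k hk'
      · simp only [mul_zero, Nat.cast_zero, neg_zero] at hk
        have h1 := congrFun h ⟨i, j, ⟨(-k - 1).toNat, by omega⟩⟩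
        rw [hT] at h1
        simp only at h1
        rwa [Int.toNat_of_nonneg (by omega), show -(-k - 1) - 1 = k by ring] at h1
  · intro y
    let w : ∀ i, Fin (m i) → LaurentSeries K := fun i j =>
      ∑ l : Fin (pole (f i) * N), single (-((l : ℕ) : ℤ) - 1) (y ⟨i, j, l⟩)
    have hw : ∀ i j, w i j ∈ lattice K (-((pole (f i) * N : ℕ) : ℤ)) := fun i j =>
      sum_mem fun l _ => lattice_mono (by omega) (single_mem_lattice _ _)
    refine ⟨w, mem_growthLattice.2 hw, ?_⟩
    funext ⟨i, j, l⟩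
    change (w i j).coeff _ = _
    simp only [w, coeff_sum]
    rw [Finset.sum_eq_single l]
    · rw [coeff_single_same]
    · intro l' _ hl'
      refine coeff_single_of_ne fun h => hl' (Fin.ext ?_)
      omega
    · simp

theorem quotLength_xPow_growthLattice (k : ℕ) :
    quotLength ((growthLattice f q m 0).map (xPow K _ k)) (growthLattice f q m 0) ≠ ⊤ := by
  -- These are the coefficients at the exponents from `0` to `q_i k - 1`; when they vanish, `x ^
  -- (-k) v` still lies in the lattice.
  let ι := Σ i, Fin (m i) × Fin (q i * k)
  let T : (∀ i, Fin (m i) → Ram K (q i)) →ₗ[K] (ι → K) :=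
    LinearMap.pi fun p => ramCoeff K (q p.1) ((p.2.2 : ℕ) : ℤ) ∘ₗ LinearMap.proj p.2.1 ∘ₗ
      LinearMap.proj p.1
  refine quotLength_ne_top T fun v hv h => ?_
  refine ⟨(single (-(k : ℤ)) 1 : LaurentSeries K) • v, mem_growthLattice.2 fun i j l hl => ?_, ?_⟩
  · refine (ramCoeff_single_smul (-(k : ℤ)) l (v i j)).trans ?_
    rw [mul_zero, Nat.cast_zero, neg_zero] at hl
    rw [mul_neg, sub_neg_eq_add]
    rcases lt_or_ge (l + (((q i : ℕ+) : ℕ) : ℤ) * k) 0 with h0 | h0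
    · exact mem_growthLattice.1 hv i j _ (by simpa using h0)
    · have h1 := congrFun h ⟨i, j, ⟨(l + (((q i : ℕ+) : ℕ) : ℤ) * k).toNat, by
        zify; rw [Int.toNat_of_nonneg h0]; omega⟩⟩
      change ramCoeff K (q i) (((l + (((q i : ℕ+) : ℕ) : ℤ) * k).toNat : ℕ) : ℤ) (v i j) = 0 at h1
      rwa [Int.toNat_of_nonneg h0] at h1
  · rw [xPow_apply, smul_smul, single_mul_single]
    simp

end

/-! ### Action of `x∇` on the lattices and uniqueness of the irregularity -/

section
variable [CharZero K]

theorem delta_elementary_mem {f : LaurentSeries K} {q : ℕ+} {n : ℤ} {v : Ram K q}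
    (hv : v ∈ ramLattice K q n) :
    (elementary f q).delta v ∈ ramLattice K q (n - pole f) := by
  have H : ∀ v ∈ lattice K n, ramHom K q (single 1 1) * elementaryOp f q v ∈
      lattice K (n - pole f) := by
    intro v hv
    rw [single_smul_elementaryOp]
    refine add_mem (Submodule.smul_mem _ _ (lattice_mono (by omega) (euler_mem_lattice hv))) ?_
    have := mul_mem_lattice (mem_lattice_neg_pole f) hv
    rwa [neg_add_eq_sub] at this
  exact H v hv

/-- In `x∇ = q⁻¹ t d/dt + f` the first term preserves the order. If `f` has a pole, multiplication
by `f` dominates, and `w = f⁻¹ v` solves the equation up to that first term; if not, there is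
nothing to gain and `w = 0` will do. -/
theorem exists_sub_delta_mem {f : LaurentSeries K} {q : ℕ+} {n : ℤ} {v : Ram K q}
    (hv : v ∈ ramLattice K q (n - pole f)) :
    ∃ w ∈ ramLattice K q n, v - (elementary f q).delta w ∈ ramLattice K q n := by
  have H : ∀ v ∈ lattice K (n - pole f), ∃ w ∈ lattice K n,
      v - ramHom K q (single 1 1) * elementaryOp f q w ∈ lattice K n := by
    intro v hv
    simp only [single_smul_elementaryOp]
    by_cases hp : pole f = 0
    · refine ⟨0, zero_mem _, ?_⟩
      have : euler (0 : LaurentSeries K) = 0 := by ext; simp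
      rw [this, smul_zero, mul_zero, add_zero, sub_zero]
      simpa [hp] using hv
    · have hf : f ≠ 0 := by rintro rfl; simp [pole] at hp
      have hw : f⁻¹ * v ∈ lattice K n := by
        have h1 := mul_mem_lattice (mem_lattice_order f⁻¹) hv
        rw [order_inv_eq hf] at h1
        refine lattice_mono ?_ h1
        unfold pole at hp ⊢
        omega
      refine ⟨f⁻¹ * v, hw, ?_⟩
      rw [mul_inv_cancel_left₀ hf, sub_add_cancel_right]
      exact neg_mem (Submodule.smul_mem _ _ (euler_mem_lattice hw))
  exact H v hv

variable {n : ℕ} {f : Fin n → LaurentSeries K} {q m : Fin n → ℕ+}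

theorem delta_directSum_tensorJordan (v : ∀ i, Fin (m i) → Ram K (q i)) (i : Fin n)
    (j : Fin (m i)) :
    (Connection.directSum fun i => (elementary (f i) (q i)).tensorJordan (m i)).delta v i j =
      (elementary (f i) (q i)).delta (v i j) +
        if h : (j : ℕ) + 1 < m i then v i ⟨j + 1, h⟩ else 0 := by
  change (single 1 1 : LaurentSeries K) • ((elementary (f i) (q i)).nabla (v i j) +
    if h : (j : ℕ) + 1 < m i then (single (-1) 1 : LaurentSeries K) • v i ⟨j + 1, h⟩ else 0) = _
  rw [smul_add]
  congr 1
  split_ifs with h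
  · rw [smul_smul, single_mul_single]
    simp
  · rw [smul_zero]

/-- Each application of `x∇` allows `pole (f i)` further polar coefficients in each of the `m i`
components. The nilpotent part only moves entries between components of the same `E_{f,q}`, without
a pole, so it stays inside the lattice. -/
theorem isGrowthFiltration_directSum :
    IsGrowthFiltration
      (Connection.directSum fun i => (elementary (f i) (q i)).tensorJordan (m i))
      (growthLattice f q m) (∑ i, (m i : ℕ) * pole (f i)) := by
  have hN : ∀ (i : Fin n) (N : ℕ), -((pole (f i) * (N + 1) : ℕ) : ℤ) =
      -((pole (f i) * N : ℕ) : ℤ) - pole (f i) := fun i N => by push_cast; ring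
  have hmono : ∀ N, growthLattice f q m N ≤ growthLattice f q m (N + 1) := by
    intro N v hv
    rw [mem_growthLattice] at hv ⊢
    exact fun i j => lattice_mono (by rw [hN]; omega) (hv i j)
  have hshift : ∀ {N : ℕ} {w : ∀ i, Fin (m i) → Ram K (q i)}, w ∈ growthLattice f q m N →
      ∀ i (j : Fin (m i)), (if h : (j : ℕ) + 1 < m i then w i ⟨j + 1, h⟩ else 0) ∈
        ramLattice K (q i) (-((pole (f i) * N : ℕ) : ℤ)) := by
    intro N w hw i j
    split_ifs with h
    · exact mem_growthLattice.1 hw i _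
    · exact zero_mem _
  refine ⟨hmono, fun N v hv => ?_, fun N v hv => ?_, fun N a v hv => ?_,
    growthLattice_exhaustive, growthLattice_bounded, quotLength_growthLattice,
    quotLength_xPow_growthLattice⟩
  · refine mem_growthLattice.2 fun i j => ?_
    rw [delta_directSum_tensorJordan]
    refine add_mem ?_ (hshift (hmono N hv) i j)
    rw [hN]
    exact delta_elementary_mem (mem_growthLattice.1 hv i j)
  · have h1 := fun i j => exists_sub_delta_mem (hN i N ▸ mem_growthLattice.1 hv i j)
    choose w hw hw' using h1
    have hwm : w ∈ growthLattice f q m N := mem_growthLattice.2 hw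
    refine ⟨v - Connection.delta _ w, mem_growthLattice.2 fun i j => ?_, w, hwm,
      (sub_add_cancel _ _).symm⟩
    rw [Pi.sub_apply, Pi.sub_apply, delta_directSum_tensorJordan, ← sub_sub]
    exact sub_mem (hw' i j) (hshift hwm i j)
  · exact mem_growthLattice.2 fun i j => smul_mem_ramLattice a (mem_growthLattice.1 hv i j)

theorem HasIrregularity.unique {V : Type*} [AddCommGroup V] [Module (LaurentSeries K) V]
    {D : Connection K V} {r r' : ℕ} (h : HasIrregularity D r) (h' : HasIrregularity D r') :
    r = r' := by
  obtain ⟨n, f, q, m, -, hD, rfl⟩ := h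
  obtain ⟨n', f', q', m', -, hD', rfl⟩ := h'
  exact le_antisymm
    (isGrowthFiltration_directSum.le_of_iso isGrowthFiltration_directSum (hD.symm.trans hD'))
    (isGrowthFiltration_directSum.le_of_iso isGrowthFiltration_directSum (hD'.symm.trans hD))

theorem HasIrregularity.existsUnique {V : Type*} [AddCommGroup V] [Module (LaurentSeries K) V]
    {D : Connection K V} {r : ℕ} (h : HasIrregularity D r) : ∃! r, HasIrregularity D r :=
  ⟨r, h, fun _ h' => h'.unique h⟩

theorem HasIrregularity.irr_eq {V : Type*} [AddCommGroup V] [Module (LaurentSeries K) V]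
    {D : Connection K V} {r : ℕ} (h : HasIrregularity D r) : irr D = r :=
  (Nat.sInf_mem (s := {r | HasIrregularity D r}) ⟨r, h⟩).unique h

end

/-! ### The ring `K[[x, y]]` as `K[[x]][[y]]` and Weierstrass division -/

/-- `K[[x, y]] = K[[x]][[y]]`. -/
def iteratedEquiv (K : Type*) [Field K] :
    MvPowerSeries (Fin 2) K ≃ₐ[K] PowerSeries (PowerSeries K) :=
  (MvPowerSeries.renameEquiv K ((Equiv.swap (0 : Fin 2) 1).trans
    ((finSuccEquiv 1).trans (Equiv.optionCongr (Equiv.ofUnique (Fin 1) Unit))))).trans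
    (MvPowerSeries.optionEquivLeft Unit K)

theorem coeff_coeff_iteratedEquiv (F : MvPowerSeries (Fin 2) K) (a b : ℕ) :
    PowerSeries.coeff a (PowerSeries.coeff b (iteratedEquiv K F)) =
      MvPowerSeries.coeff (Finsupp.single 0 a + Finsupp.single 1 b) F := by
  let σ : Fin 2 ≃ Option Unit := (Equiv.swap (0 : Fin 2) 1).trans
    ((finSuccEquiv 1).trans (Equiv.optionCongr (Equiv.ofUnique (Fin 1) Unit)))
  have h0 : σ 0 = some () := rfl
  have h1 : σ 1 = none := rfl
  change MvPowerSeries.coeff (Finsupp.single () a) (PowerSeries.coeff b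
    (MvPowerSeries.optionEquivLeft Unit K (MvPowerSeries.rename σ F))) = _
  rw [MvPowerSeries.coeff_coeff_optionEquivLeft,
    ← MvPowerSeries.coeff_embDomain_rename σ.toEmbedding]
  congr 2
  rw [Finsupp.embDomain_eq_mapDomain, Finsupp.mapDomain_add, Finsupp.mapDomain_single,
    Finsupp.mapDomain_single, Equiv.coe_toEmbedding, h0, h1]
  refine Finsupp.ext fun t => ?_
  cases t <;> simp

theorem iteratedEquiv_eq_coe {F : MvPowerSeries (Fin 2) K} {P : Polynomial (PowerSeries K)}
    (h : ∀ m, MvPowerSeries.coeff m F = PowerSeries.coeff (m 0) (P.coeff (m 1))) :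
    iteratedEquiv K F = (P : PowerSeries (PowerSeries K)) := by
  ext b a
  rw [coeff_coeff_iteratedEquiv, h, Polynomial.coeff_coe]
  simp

theorem iteratedEquiv_pderiv {F : MvPowerSeries (Fin 2) K} {P : Polynomial (PowerSeries K)}
    (h : ∀ m, MvPowerSeries.coeff m F = PowerSeries.coeff (m 0) (P.coeff (m 1))) :
    iteratedEquiv K (MvPowerSeries.pderiv K 1 F) =
      (Polynomial.derivative P : PowerSeries (PowerSeries K)) := by
  refine iteratedEquiv_eq_coe fun m => ?_
  rw [MvPowerSeries.coeff_pderiv, h, Polynomial.coeff_derivative]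
  have h1 : ((m 1 : PowerSeries K) + 1) = PowerSeries.C ((m 1 : K) + 1) := by simp
  rw [h1, PowerSeries.coeff_mul_C]
  simp

instance : IsAdicComplete (IsLocalRing.maximalIdeal (PowerSeries K)) (PowerSeries K) := by
  rw [PowerSeries.maximalIdeal_eq_span_X]
  infer_instance

section Weierstrass
variable {A : Type*} [CommRing A] {I : Ideal A} [IsAdicComplete I A] {P : Polynomial A}

/-- Weierstrass division, in the form that `A[y]/(P) → A[[y]]/(P)` is surjective; its injectivity
gives the next lemma. -/
theorem exists_eq_coe_add_mul (hP : P.IsDistinguishedAt I) (F : PowerSeries A) :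
    ∃ (R : Polynomial A) (G : PowerSeries A), F = R + P * G := by
  obtain ⟨y, hy⟩ := hP.algEquivQuotient.surjective (Ideal.Quotient.mk _ F)
  obtain ⟨R, rfl⟩ := Ideal.Quotient.mk_surjective y
  have h1 : Ideal.Quotient.mk (Ideal.span {(P : PowerSeries A)}) (R : PowerSeries A) =
      Ideal.Quotient.mk _ F := by
    simpa using hy
  rw [eq_comm, Ideal.Quotient.mk_eq_mk_iff_sub_mem, Ideal.mem_span_singleton'] at h1
  obtain ⟨G, hG⟩ := h1
  exact ⟨R, G, by rw [mul_comm, hG]; ring⟩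

theorem dvd_of_coe_dvd_coe (hP : P.IsDistinguishedAt I) {H : Polynomial A}
    (h : (P : PowerSeries A) ∣ H) : P ∣ H := by
  rw [← Ideal.mem_span_singleton, ← Ideal.Quotient.eq_zero_iff_mem]
  apply hP.algEquivQuotient.injective
  rw [map_zero]
  have := Ideal.Quotient.eq_zero_iff_mem.2 (Ideal.mem_span_singleton.2 h)
  simpa using this

end Weierstrass

/-! ### Parametrized curve germs -/

/-- The homomorphism `K[[x]] → K((t))`, `x ↦ t ^ q`. -/
def ramPowerSeries (K : Type*) [Field K] (q : ℕ+) : PowerSeries K →+* LaurentSeries K :=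
  (ramHom K q).comp (ofPowerSeries ℤ K)

theorem ramPowerSeries_apply (q : ℕ+) (a : PowerSeries K) :
    ramPowerSeries K q a = ramHom K q (ofPowerSeries ℤ K a) := rfl

theorem ramPowerSeries_C (q : ℕ+) (c : K) : ramPowerSeries K q (PowerSeries.C c) = C c := by
  rw [ramPowerSeries_apply, ofPowerSeries_C, ramHom_C]

theorem ramPowerSeries_mem_lattice (q : ℕ+) (a : PowerSeries K) :
    ramPowerSeries K q a ∈ lattice K 0 :=
  ramHom_mem_lattice (ofPowerSeries_mem_lattice a)

/-! ### The field generated by a series with `q` distinct conjugates -/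

section Param
variable {q : ℕ+} {ω : Kˣ} {α : LaurentSeries K}

/-- A polynomial over `K((x))` that vanishes at `α` vanishes at its `q` distinct conjugates, too
many for degree below `q`. -/
theorem eq_zero_of_eval₂_ramHom_eq_zero (hω : IsPrimitiveRoot ω q)
    (hα : ∀ k < (q : ℕ), ∀ l < (q : ℕ), twistHom (ω ^ k) α = twistHom (ω ^ l) α → k = l)
    {R : Polynomial (LaurentSeries K)}
    (hR : R.natDegree < q) (h : R.eval₂ (ramHom K q) α = 0) : R = 0 := by
  have h1 : R.map (ramHom K q) = 0 := by
    refine Polynomial.eq_zero_of_natDegree_lt_card_of_eval_eq_zero _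
      (f := fun k : Fin q => twistHom (ω ^ (k : ℕ)) α)
      (fun k l hkl => Fin.ext (hα k k.2 l l.2 hkl)) (fun k => ?_)
      (by rw [Fintype.card_fin]; exact (Polynomial.natDegree_map_le).trans_lt hR)
    have h2 : (twistHom (ω ^ (k : ℕ))).comp (ramHom K q) = ramHom K q := by
      ext1 v
      rw [RingHom.comp_apply, twistHom_ramHom, ← pow_mul, mul_comm, pow_mul, hω.pow_eq_one,
        one_pow, twistHom_one]
    rw [Polynomial.eval_map, ← h2, ← Polynomial.hom_eval₂, h, map_zero]
  exact (Polynomial.map_eq_zero _).1 h1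

/-- The powers `1, α, …, α ^ (q - 1)` are independent, hence a basis of the `q`-dimensional space
`K((t))`. -/
theorem exists_polynomial_eval₂_ramHom (hω : IsPrimitiveRoot ω q)
    (hα : ∀ k < (q : ℕ), ∀ l < (q : ℕ), twistHom (ω ^ k) α = twistHom (ω ^ l) α → k = l)
    (v : LaurentSeries K) :
    ∃ R : Polynomial (LaurentSeries K), R.eval₂ (ramHom K q) α = v := by
  let β : Fin q → Ram K q := fun j => (show LaurentSeries K from α ^ (j : ℕ))
  have hli : LinearIndependent (LaurentSeries K) β := by
    rw [Fintype.linearIndependent_iff]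
    intro c hc
    have h1 : (∑ j : Fin q, Polynomial.monomial (j : ℕ) (c j)).eval₂ (ramHom K q) α = 0 := by
      rw [Polynomial.eval₂_finsetSum]
      simp only [Polynomial.eval₂_monomial]
      exact hc
    have h2 := eq_zero_of_eval₂_ramHom_eq_zero hω hα (by
      refine (Polynomial.natDegree_sum_le_of_forall_le (n := q - 1) _ _ fun j _ => ?_).trans_lt
        (Nat.sub_lt q.pos one_pos)
      exact (Polynomial.natDegree_monomial_le _).trans (Nat.le_sub_one_of_lt j.2)) h1
    intro j
    have h3 := congrArg (fun R => Polynomial.coeff R (j : ℕ)) h2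
    simp only [Polynomial.finsetSum_coeff, Polynomial.coeff_monomial, Polynomial.coeff_zero]
      at h3
    rw [Finset.sum_eq_single j (fun l _ hl => if_neg fun h => hl (Fin.ext h)) (by simp)] at h3
    simpa using h3
  have hspan := hli.span_eq_top_of_card_eq_finrank' (by rw [finrank_ram, Fintype.card_fin])
  obtain ⟨c, hc⟩ : ∃ c : Fin q → LaurentSeries K, ∑ j, c j • β j = (v : Ram K q) :=
    (Submodule.mem_span_range_iff_exists_fun _).1 (hspan ▸ Submodule.mem_top)
  refine ⟨∑ j : Fin q, Polynomial.monomial (j : ℕ) (c j), ?_⟩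
  rw [Polynomial.eval₂_finsetSum]
  simp only [Polynomial.eval₂_monomial]
  exact hc

theorem dvd_of_eval₂_ramPowerSeries_eq_zero (hω : IsPrimitiveRoot ω q)
    (hα : ∀ k < (q : ℕ), ∀ l < (q : ℕ), twistHom (ω ^ k) α = twistHom (ω ^ l) α → k = l)
    {P H : Polynomial (PowerSeries K)} (hP : P.Monic)
    (hPq : P.natDegree = q) (hPα : P.eval₂ (ramPowerSeries K q) α = 0)
    (hH : H.eval₂ (ramPowerSeries K q) α = 0) : P ∣ H := by
  rw [← Polynomial.modByMonic_eq_zero_iff_dvd hP]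
  have h1 : (H %ₘ P).eval₂ (ramPowerSeries K q) α = 0 := by
    have := Polynomial.modByMonic_add_div H P
    rw [← this, Polynomial.eval₂_add, Polynomial.eval₂_mul, hPα, zero_mul, add_zero] at hH
    exact hH
  rw [ramPowerSeries, ← Polynomial.eval₂_map] at h1
  have h2 := eq_zero_of_eval₂_ramHom_eq_zero hω hα ?_ h1
  · exact (Polynomial.map_eq_zero_iff ofPowerSeries_injective).1 h2
  · refine Polynomial.natDegree_map_le.trans_lt ?_
    rw [← hPq]
    refine Polynomial.natDegree_modByMonic_lt H hP fun h => ?_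
    rw [h, Polynomial.natDegree_one] at hPq
    exact q.ne_zero hPq.symm

end Param

theorem quotLength_lattice (n : ℕ) : quotLength (lattice K n) (lattice K 0) = n := by
  let T : LaurentSeries K →ₗ[K] (Fin n → K) :=
    LinearMap.pi fun l => HahnSeries.coeff.linearMap ((l : ℕ) : ℤ)
  have hT : ∀ v l, T v l = v.coeff ((l : ℕ) : ℤ) := fun v l => rfl
  rw [quotLength_eq_card T, Fintype.card_fin]
  · intro v hv
    constructor
    · intro h
      funext l
      exact h _ (by exact_mod_cast l.2)
    · intro h k hk
      rcases lt_or_ge k 0 with h0 | h0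
      · exact hv k h0
      · lift k to ℕ using h0
        exact congrFun h ⟨k, by exact_mod_cast hk⟩
  · intro y
    refine ⟨∑ l : Fin n, single ((l : ℕ) : ℤ) (y l),
      sum_mem fun l _ => lattice_mono (by positivity) (single_mem_lattice _ _), ?_⟩
    funext l
    rw [hT, coeff_sum, Finset.sum_eq_single l]
    · rw [coeff_single_same]
    · intro l' _ hl'
      exact coeff_single_of_ne fun h => hl' (Fin.ext (by exact_mod_cast h.symm))
    · simp

/-- Multiplication by `e` as a `K`-linear map. -/
def mulLin (e : LaurentSeries K) : LaurentSeries K →ₗ[K] LaurentSeries K where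
  toFun v := e * v
  map_add' := mul_add e
  map_smul' c v := by
    rw [← C_mul_eq_smul, ← C_mul_eq_smul, mul_left_comm]
    rfl

theorem mulLin_injective {e : LaurentSeries K} (he : e ≠ 0) : Function.Injective (mulLin e) :=
  mul_right_injective₀ he

theorem map_mulLin_lattice {e : LaurentSeries K} (he : e ≠ 0) {n : ℕ} (hn : e.order = n) :
    (lattice K 0).map (mulLin e) = lattice K n := by
  apply le_antisymm
  · rintro _ ⟨v, hv, rfl⟩
    have := mul_mem_lattice (mem_lattice_order e) hv
    rwa [hn, add_zero] at this
  · intro v hv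
    refine ⟨e⁻¹ * v, ?_, mul_inv_cancel_left₀ he v⟩
    have := mul_mem_lattice (mem_lattice_order e⁻¹) hv
    rwa [order_inv_eq he, hn, neg_add_cancel] at this

/-- Colength is unchanged on passing to a subspace of finite codimension. -/
theorem quotLength_map_mulLin {A : Submodule K (LaurentSeries K)} (hA : A ≤ lattice K 0) {c : ℕ}
    (hc : lattice K c ≤ A) {e : LaurentSeries K} (he : e ≠ 0) (heA : A.map (mulLin e) ≤ A) {n : ℕ}
    (hn : e.order = n) : quotLength (A.map (mulLin e)) A = n := by
  have hfin : quotLength A (lattice K 0) ≠ ⊤ :=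
    ne_top_of_le_ne_top (by rw [quotLength_lattice]; exact ENat.natCast_ne_top c)
      (quotLength_le_left hc hA)
  -- With `L = K[[t]]`, the length of `L / eA` is computed through `A` and through `eL`. Since `L /
  -- A` and `eL / eA` have the same finite length, `A / eA` and `L / eL` do too.
  have h1 := quotLength_add heA hA
  have h2 := quotLength_add (Submodule.map_mono (f := mulLin e) hA)
    (show (lattice K 0).map (mulLin e) ≤ lattice K 0 by
      rw [map_mulLin_lattice he hn]; exact lattice_mono (by positivity))
  rw [quotLength_map _ _ (mulLin_injective he)] at h2
  rw [map_mulLin_lattice he hn, quotLength_lattice] at h2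
  rw [h2, add_comm] at h1
  exact (ENat.add_left_injective_of_ne_top hfin h1).symm

theorem iteratedEquiv_symm_C_C (c : K) :
    (iteratedEquiv K).symm (PowerSeries.C (PowerSeries.C c)) = MvPowerSeries.C c := by
  classical
  rw [AlgEquiv.symm_apply_eq]
  ext b a
  rw [coeff_coeff_iteratedEquiv, MvPowerSeries.coeff_C, PowerSeries.coeff_C]
  by_cases hb : b = 0
  · subst hb
    rw [if_pos rfl, PowerSeries.coeff_C]
    by_cases ha : a = 0 <;> simp [ha]
  · rw [if_neg hb, map_zero, if_neg]
    intro h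
    exact hb (by simpa using DFunLike.congr_fun h 1)

/-! ### Intersection numbers along a parametrization -/

section Param
variable {q : ℕ+} {α : LaurentSeries K}

/-- The evaluation `H(x, y) ↦ H(t ^ q, α(t))` as a `K`-linear map. -/
def evalLin (q : ℕ+) (α : LaurentSeries K) : Polynomial (PowerSeries K) →ₗ[K] LaurentSeries K where
  toFun H := H.eval₂ (ramPowerSeries K q) α
  map_add' _ _ := Polynomial.eval₂_add _ _
  map_smul' c H := by
    have h1 : c • H = Polynomial.C (PowerSeries.C c) * H := by
      rw [Algebra.smul_def]
      rfl
    rw [h1, Polynomial.eval₂_mul, Polynomial.eval₂_C, ramPowerSeries_C, C_mul_eq_smul]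
    rfl

theorem evalLin_apply (H : Polynomial (PowerSeries K)) :
    evalLin q α H = H.eval₂ (ramPowerSeries K q) α := rfl

theorem evalLin_mul (H H' : Polynomial (PowerSeries K)) :
    evalLin q α (H * H') = evalLin q α H * evalLin q α H' := Polynomial.eval₂_mul _ _

theorem pow_mem_lattice (hα : α ∈ lattice K 0) (n : ℕ) : α ^ n ∈ lattice K 0 := by
  induction n with
  | zero => exact single_mem_lattice 0 1
  | succ n ih => simpa [pow_succ] using mul_mem_lattice ih hα

theorem range_evalLin_le (hα : α ∈ lattice K 0) :
    LinearMap.range (evalLin q α) ≤ lattice K 0 := by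
  rintro _ ⟨H, rfl⟩
  rw [evalLin_apply, Polynomial.eval₂_eq_sum_range]
  exact sum_mem fun i _ => by
    simpa using mul_mem_lattice (ramPowerSeries_mem_lattice q (H.coeff i)) (pow_mem_lattice hα i)

/-- The image of `K[[x]][y]` contains a conductor. Clearing denominators puts a multiple `x ^ k v`
of any `v` into it, one `k` serves all of `K[[t]]`, and `x ^ k = t ^ (q k)`. -/
theorem exists_lattice_le_range_evalLin {ω : Kˣ} (hω : IsPrimitiveRoot ω q)
    (hα : ∀ k < (q : ℕ), ∀ l < (q : ℕ), twistHom (ω ^ k) α = twistHom (ω ^ l) α → k = l) :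
    ∃ c : ℕ, lattice K c ≤ LinearMap.range (evalLin q α) := by
  have hex : ∀ v : LaurentSeries K, ∃ k : ℕ,
      ramHom K q (single (k : ℤ) 1) * v ∈ LinearMap.range (evalLin q α) := by
    intro v
    obtain ⟨R, rfl⟩ := exists_polynomial_eval₂_ramHom hω hα v
    set k := ∑ i ∈ R.support, pole (R.coeff i) with hk
    have hl : Polynomial.C (single (k : ℤ) 1) * R ∈ Polynomial.lifts (ofPowerSeries ℤ K) := by
      rw [Polynomial.lifts_iff_coeff_lifts]
      intro i
      rw [Polynomial.coeff_C_mul]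
      refine exists_ofPowerSeries_eq ?_
      by_cases hi : i ∈ R.support
      · have h1 : pole (R.coeff i) ≤ k :=
          Finset.single_le_sum (f := fun i => pole (R.coeff i)) (fun _ _ => Nat.zero_le _) hi
        exact lattice_mono (by omega)
          (mul_mem_lattice (single_mem_lattice (k : ℤ) 1) (mem_lattice_neg_pole (R.coeff i)))
      · rw [Polynomial.notMem_support_iff.1 hi, mul_zero]
        exact zero_mem _
    obtain ⟨H, hH⟩ := (Polynomial.mem_lifts _).1 hl
    refine ⟨k, H, ?_⟩
    rw [evalLin_apply, ramPowerSeries, ← Polynomial.eval₂_map, hH, Polynomial.eval₂_mul,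
      Polynomial.eval₂_C]
  obtain ⟨k, hk⟩ := ramLattice_bounded (q := q) (LinearMap.range (evalLin q α))
    (fun a v hv => by
      obtain ⟨H, rfl⟩ := hv
      have h1 : evalLin q α (Polynomial.C a * H) =
          ramHom K q (ofPowerSeries ℤ K a) * evalLin q α H := by
        rw [evalLin_mul, evalLin_apply, Polynomial.eval₂_C, ramPowerSeries_apply]
      exact ⟨_, h1⟩) hex
  refine ⟨q * k, fun v hv => ?_⟩
  have h1 : single (-((q * k : ℕ) : ℤ)) 1 * v ∈ lattice K 0 := by
    have := mul_mem_lattice (single_mem_lattice (-((q * k : ℕ) : ℤ)) 1) hv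
    rwa [neg_add_cancel] at this
  have h2 : ramHom K q (single (k : ℤ) 1) * (single (-((q * k : ℕ) : ℤ)) 1 * v) ∈
      LinearMap.range (evalLin q α) := hk _ h1
  rw [ramHom_single, ← mul_assoc, single_mul_single] at h2
  simpa using h2

variable {ω : Kˣ} {P Q : Polynomial (PowerSeries K)}

/-- The intersection number of a parametrized germ with another germ is the order of the second
along the parametrization. -/
theorem intersectionNumber_eq_order (hω : IsPrimitiveRoot ω q)
    (hα : ∀ k < (q : ℕ), ∀ l < (q : ℕ), twistHom (ω ^ k) α = twistHom (ω ^ l) α → k = l)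
    (hα0 : α ∈ lattice K 0)
    (hP : P.IsDistinguishedAt (IsLocalRing.maximalIdeal (PowerSeries K))) (hPq : P.natDegree = q)
    (hPα : P.eval₂ (ramPowerSeries K q) α = 0) (hQ : Q.eval₂ (ramPowerSeries K q) α ≠ 0)
    {F G : MvPowerSeries (Fin 2) K} (hF : iteratedEquiv K F = P) (hG : iteratedEquiv K G = Q) :
    Module.Finite K (IntersectionAlgebra F G) ∧
      (intersectionNumber F G : ℤ) = (Q.eval₂ (ramPowerSeries K q) α).order := by
  set e := Q.eval₂ (ramPowerSeries K q) α with he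
  set A := LinearMap.range (evalLin q α) with hA
  have hAle : A ≤ lattice K 0 := range_evalLin_le hα0
  have hn : e.order = (e.order.toNat : ℤ) := by
    refine (Int.toNat_of_nonneg ?_).symm
    rw [le_order_iff_forall hQ]
    exact hAle ⟨Q, rfl⟩
  obtain ⟨c, hc⟩ := exists_lattice_le_range_evalLin hω hα
  have heA : A.map (mulLin e) ≤ A := by
    rintro _ ⟨_, ⟨H, rfl⟩, rfl⟩
    exact ⟨Q * H, evalLin_mul _ _⟩
  have hlen := quotLength_map_mulLin hAle hc hQ heA hn
  let π : Polynomial (PowerSeries K) →ₗ[K] IntersectionAlgebra F G :=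
    { toFun := fun H => Ideal.Quotient.mk _ ((iteratedEquiv K).symm H)
      map_add' := fun H H' => by rw [Polynomial.coe_add, map_add, map_add]
      map_smul' := fun c H => by
        have h1 : c • H = Polynomial.C (PowerSeries.C c) * H := by
          rw [Algebra.smul_def]
          rfl
        rw [h1, Polynomial.coe_mul, Polynomial.coe_C, map_mul, iteratedEquiv_symm_C_C,
          ← MvPowerSeries.smul_eq_C_mul]
        rfl }
  -- Modulo `P`, Weierstrass division replaces a power series in `y` by a polynomial.
  have hπ : Function.Surjective π := by
    intro z
    obtain ⟨z, rfl⟩ := Ideal.Quotient.mk_surjective z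
    obtain ⟨R, S, hRS⟩ := exists_eq_coe_add_mul hP (iteratedEquiv K z)
    refine ⟨R, ?_⟩
    refine (Ideal.Quotient.mk_eq_mk_iff_sub_mem _ _).2 (Ideal.mem_span_pair.2
      ⟨-(iteratedEquiv K).symm S, 0, ?_⟩)
    apply (iteratedEquiv K).injective
    simp only [map_add, map_mul, map_neg, map_sub, AlgEquiv.apply_symm_apply, hF, map_zero, hRS]
    ring
  let ρ : Polynomial (PowerSeries K) →ₗ[K] (A ⧸ (A.map (mulLin e)).submoduleOf A) :=
    Submodule.mkQ _ ∘ₗ (evalLin q α).rangeRestrict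
  have hρ : Function.Surjective ρ :=
    (Submodule.mkQ_surjective _).comp (LinearMap.surjective_rangeRestrict _)
  -- Both kernels are the ideal `(P, Q)` of `K[[x]][y]`: a relation `H = S P + T Q` over power
  -- series becomes polynomial after dividing `T` by `P`, and a polynomial vanishing along the
  -- parametrization is a multiple of `P`.
  have hker : LinearMap.ker π = LinearMap.ker ρ := by
    ext H
    have h1 : H ∈ LinearMap.ker ρ ↔ evalLin q α H ∈ A.map (mulLin e) := by
      rw [LinearMap.mem_ker]
      exact Submodule.Quotient.mk_eq_zero _
    have h2 : H ∈ LinearMap.ker π ↔ (iteratedEquiv K).symm H ∈ Ideal.span {F, G} := by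
      rw [LinearMap.mem_ker]
      exact Ideal.Quotient.eq_zero_iff_mem
    rw [h1, h2, Ideal.mem_span_pair]
    constructor
    · rintro ⟨S, T, hST⟩
      have h3 := congrArg (iteratedEquiv K) hST
      rw [map_add, map_mul, map_mul, hF, hG, AlgEquiv.apply_symm_apply] at h3
      obtain ⟨R, U, hRU⟩ := exists_eq_coe_add_mul hP (iteratedEquiv K T)
      have h4 : P ∣ H - Q * R := by
        refine dvd_of_coe_dvd_coe hP ⟨iteratedEquiv K S + U * Q, ?_⟩
        rw [Polynomial.coe_sub, Polynomial.coe_mul, ← h3, hRU]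
        ring
      obtain ⟨W, hW⟩ := h4
      refine ⟨evalLin q α R, ⟨R, rfl⟩, ?_⟩
      have h5 : evalLin q α (H - Q * R) = 0 := by
        rw [hW, evalLin_mul, evalLin_apply, hPα, zero_mul]
      rw [map_sub, evalLin_mul, sub_eq_zero] at h5
      exact h5.symm
    · rintro ⟨_, ⟨R, rfl⟩, hR⟩
      have h5 : evalLin q α (H - Q * R) = 0 := by
        rw [map_sub, evalLin_mul, sub_eq_zero]
        exact hR.symm
      obtain ⟨W, hW⟩ := dvd_of_eval₂_ramPowerSeries_eq_zero hω hα hP.monic hPq hPα h5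
      refine ⟨(iteratedEquiv K).symm W, (iteratedEquiv K).symm R, ?_⟩
      apply (iteratedEquiv K).injective
      simp only [map_add, map_mul, AlgEquiv.apply_symm_apply, hF, hG]
      have h6 : H = P * W + Q * R := by rw [← hW]; ring
      rw [h6, Polynomial.coe_add, Polynomial.coe_mul, Polynomial.coe_mul]
      ring
  have hlen' : Module.length K (IntersectionAlgebra F G) = (e.order.toNat : ℕ∞) := by
    rw [← hlen, quotLength, ← (LinearMap.quotKerEquivOfSurjective ρ hρ).length_eq, ← hker,
      (LinearMap.quotKerEquivOfSurjective π hπ).length_eq]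
  have hfin : Module.Finite K (IntersectionAlgebra F G) := by
    have h1 : IsFiniteLength K (IntersectionAlgebra F G) :=
      Module.length_ne_top_iff.1 (by rw [hlen']; exact ENat.natCast_ne_top _)
    have := (isFiniteLength_iff_isNoetherian_isArtinian.1 h1).1
    infer_instance
  refine ⟨hfin, ?_⟩
  rw [Module.length_eq_finrank] at hlen'
  rw [hn, intersectionNumber]
  exact_mod_cast hlen'

/-- A germ that does not pass through the origin meets nothing there. -/
theorem intersectionAlgebra_of_isUnit {F G : MvPowerSeries (Fin 2) K} (hF : IsUnit F) :
    Module.Finite K (IntersectionAlgebra F G) ∧ intersectionNumber F G = 0 := by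
  have h1 : Ideal.span {F, G} = ⊤ :=
    Ideal.eq_top_of_isUnit_mem _ (Ideal.subset_span (by simp)) hF
  have : Subsingleton (IntersectionAlgebra F G) := Ideal.Quotient.subsingleton_iff.2 h1
  exact ⟨inferInstance, Module.finrank_zero_of_subsingleton⟩

end Param

/-! ### The polynomial of the curve `C_{f,q}` -/

section Curve
variable {q : ℕ+} {ω : Kˣ} {f : LaurentSeries K}

theorem curvePoly_eq_prod (hω : IsPrimitiveRoot ω q) (f : LaurentSeries K) :
    curvePoly f q = ∏ k ∈ Finset.range q,
      (Polynomial.X - Polynomial.C (twistHom (ω ^ k) f)⁻¹) := by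
  classical
  have hω' : IsPrimitiveRoot (ω : K) q := IsPrimitiveRoot.coe_units_iff.2 hω
  have h1 : Polynomial.nthRootsFinset (q : ℕ) (1 : K) =
      (Finset.range q).image fun k => (ω : K) ^ k := by
    symm
    refine Finset.eq_of_subset_of_card_le (fun x hx => ?_) ?_
    · obtain ⟨k, -, rfl⟩ := Finset.mem_image.1 hx
      rw [Polynomial.mem_nthRootsFinset q.pos, ← pow_mul, mul_comm, pow_mul, hω'.pow_eq_one,
        one_pow]
    · rw [hω'.card_nthRootsFinset, Finset.card_image_of_injOn, Finset.card_range]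
      intro k hk l hl h
      exact hω'.pow_inj (Finset.mem_range.1 hk) (Finset.mem_range.1 hl) h
  rw [curvePoly, h1, Finset.prod_image]
  · simp only [twistHom_apply, Units.val_pow_eq_pow_val]
  · intro k hk l hl h
    exact hω'.pow_inj (Finset.mem_range.1 hk) (Finset.mem_range.1 hl) h

theorem inv_twistHom_mem_lattice (hf : f ≠ 0) (c : Kˣ) :
    (twistHom c f)⁻¹ ∈ lattice K (-f.order) := by
  have h := mem_lattice_order (twistHom c f)⁻¹
  rwa [order_inv_eq ((map_ne_zero _).2 hf), order_twistHom] at h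

/-- `C_{f,q}` is a monic polynomial of degree `q` in `y` over `K[[x]]`. -/
theorem exists_curve_polynomial (hω : IsPrimitiveRoot ω q) (hf : f ≠ 0) (hf0 : f.order ≤ 0) :
    ∃ P : Polynomial (PowerSeries K), P.Monic ∧ P.natDegree = q ∧
      P.map (ramPowerSeries K q) = ∏ k ∈ Finset.range q,
        (Polynomial.X - Polynomial.C (twistHom (ω ^ k) f)⁻¹) ∧
      (∀ m, MvPowerSeries.coeff m (curve f q) = PowerSeries.coeff (m 0) (P.coeff (m 1))) ∧
      (f.order < 0 → P.IsDistinguishedAt (IsLocalRing.maximalIdeal (PowerSeries K))) := by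
  set R : Polynomial (LaurentSeries K) := ∏ k ∈ Finset.range q,
    (Polynomial.X - Polynomial.C (twistHom (ω ^ k) f)⁻¹) with hR
  have hmonic : R.Monic := Polynomial.monic_prod_X_sub_C _ _
  have hdeg : R.natDegree = q := by
    rw [hR, Polynomial.natDegree_prod_of_monic _ _ fun k _ => Polynomial.monic_X_sub_C _]
    simp
  -- The substitution `t ↦ ω t` permutes the factors cyclically.
  have htw : R.map (twistHom ω) = R := by
    rw [hR, Polynomial.map_prod]
    simp only [Polynomial.map_sub, Polynomial.map_X, Polynomial.map_C, map_inv₀,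
      twistHom_twistHom, ← pow_succ']
    have h1 := Finset.prod_range_succ
      (fun k => (Polynomial.X - Polynomial.C (twistHom (ω ^ k) f)⁻¹)) q
    rw [Finset.prod_range_succ', hω.pow_eq_one, pow_zero] at h1
    exact mul_right_cancel₀ (Polynomial.X_sub_C_ne_zero _) h1
  choose β hβ using fun k : ℕ =>
    exists_ofPowerSeries_eq (lattice_mono (by omega) (inv_twistHom_mem_lattice hf (ω ^ k)))
  set S : Polynomial (PowerSeries K) := ∏ k ∈ Finset.range q,
    (Polynomial.X - Polynomial.C (β k)) with hS
  have hSR : S.map (ofPowerSeries ℤ K) = R := by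
    rw [hS, Polynomial.map_prod]
    simp only [Polynomial.map_sub, Polynomial.map_X, Polynomial.map_C, hβ]
    rfl
  -- Invariance leaves only exponents divisible by `q`, and `R` already has coefficients in
  -- `K[[t]]`; together they lie in `K[[t ^ q]]`.
  have hlift : R ∈ Polynomial.lifts (ramPowerSeries K q) := by
    rw [Polynomial.lifts_iff_coeff_lifts]
    intro i
    have h1 : ∀ n, (R.coeff i).coeff n ≠ 0 → ((q : ℕ) : ℤ) ∣ n := by
      intro n hn
      have h2 := congrArg (fun T : Polynomial (LaurentSeries K) => (T.coeff i).coeff n) htw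
      simp only [Polynomial.coeff_map, twistHom_coeff] at h2
      have h3 : ω ^ n = 1 := by
        ext
        rw [Units.val_zpow_eq_zpow_val, Units.val_one]
        exact mul_right_cancel₀ hn (h2.trans (one_mul _).symm)
      exact (hω.zpow_eq_one_iff_dvd n).1 h3
    obtain ⟨a, ha⟩ : ∃ a, ofPowerSeries ℤ K a = residuePart q 0 (R.coeff i) := by
      refine exists_ofPowerSeries_eq fun n hn => ?_
      change (R.coeff i).coeff (((q : ℕ) : ℤ) * n + 0) = 0
      rw [← hSR, Polynomial.coeff_map]
      refine ofPowerSeries_coeff_of_neg _ ?_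
      have : (0 : ℤ) < ((q : ℕ) : ℤ) := by exact_mod_cast q.pos
      nlinarith
    refine ⟨a, ?_⟩
    rw [ramPowerSeries_apply, ha, ramHom_residuePart h1]
  obtain ⟨P, hPR, hPdeg, hPm⟩ := Polynomial.lifts_and_natDegree_eq_and_monic hlift hmonic
  have hcoeff : ∀ i a : ℕ, ((R.coeff i)).coeff (((q : ℕ) : ℤ) * (a : ℤ)) =
      PowerSeries.coeff a (P.coeff i) := by
    intro i a
    rw [← hPR, Polynomial.coeff_map, ramPowerSeries_apply, ramHom_coeff_mul,
      ofPowerSeries_apply_coeff]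
  refine ⟨P, hPm, hPdeg.trans hdeg, hPR, fun m => ?_, fun hlt => ⟨⟨fun {i} hi => ?_⟩, hPm⟩⟩
  · rw [← hcoeff, hR, ← curvePoly_eq_prod hω]
    rfl
  · rw [PowerSeries.maximalIdeal_eq_span_X, Ideal.mem_span_singleton, PowerSeries.X_dvd_iff,
      ← PowerSeries.coeff_zero_eq_constantCoeff_apply, ← hcoeff, ← hSR, Polynomial.coeff_map,
      Nat.cast_zero, mul_zero]
    have h0 := ofPowerSeries_apply_coeff (Γ := ℤ) (S.coeff i) 0
    rw [Nat.cast_zero] at h0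
    rw [h0, PowerSeries.coeff_zero_eq_constantCoeff_apply, ← Polynomial.coeff_map, hS,
      Polynomial.map_prod]
    -- When `f` has a pole all roots `1 / f(ω^k t)` vanish at `t = 0`, so the polynomial reduces to
    -- `y ^ q`.
    have hβ0 : ∀ k, PowerSeries.constantCoeff (β k) = 0 := by
      intro k
      have h1 := ofPowerSeries_apply_coeff (Γ := ℤ) (β k) 0
      rw [hβ, PowerSeries.coeff_zero_eq_constantCoeff_apply] at h1
      rw [← h1]
      exact inv_twistHom_mem_lattice hf (ω ^ k) _ (by simp; omega)
    simp only [Polynomial.map_sub, Polynomial.map_X, Polynomial.map_C, hβ0, Polynomial.C_0,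
      sub_zero, Finset.prod_const, Finset.card_range, Polynomial.coeff_X_pow]
    rw [hPdeg, hdeg] at hi
    exact if_neg hi.ne

end Curve

/-! ### Irregularity and intersection numbers -/

/-- Some polar exponent `n` is not divisible by the order of `c`; there `c ^ n ≠ 1`, and the
coefficient survives in the difference. -/
theorem PolarlyPrimitive.order_sub_twistHom_neg {f : LaurentSeries K} {q : ℕ+}
    (h : PolarlyPrimitive f q) {c : Kˣ} (hc : c ^ (q : ℕ) = 1) (hc1 : c ≠ 1) :
    (f - twistHom c f).order < 0 := by
  have h0 : 0 < orderOf c := orderOf_pos_iff.2 (isOfFinOrder_iff_pow_eq_one.2 ⟨q, q.pos, hc⟩)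
  have h1 : orderOf c ≠ 1 := fun h => hc1 (orderOf_eq_one_iff.1 h)
  obtain ⟨n, hn, hfn, hdvd⟩ := h (orderOf c) (by omega) (orderOf_dvd_of_pow_eq_one hc)
  refine (order_le_of_coeff_ne_zero (g := n) ?_).trans_lt hn
  rw [coeff_sub, twistHom_coeff, ← one_sub_mul]
  refine mul_ne_zero (fun h2 => hdvd (orderOf_dvd_iff_zpow_eq_one.2 ?_)) hfn
  ext
  rw [Units.val_zpow_eq_zpow_val, Units.val_one]
  exact (sub_eq_zero.1 h2).symm

theorem PolarlyPrimitive.eq_one {f : LaurentSeries K} {q : ℕ+} (h : PolarlyPrimitive f q)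
    (hf : 0 ≤ f.order) : q = 1 := by
  by_contra hq
  have h1 : (q : ℕ) ≠ 1 := fun h => hq (PNat.eq h)
  obtain ⟨n, hn, hfn, -⟩ := h q (by have := q.pos; omega) dvd_rfl
  exact hfn (coeff_eq_zero_of_lt_order (hn.trans_le hf))

theorem PolarlyPrimitive.twistHom_inv_injective {g : LaurentSeries K} {q : ℕ+} {ω : Kˣ}
    (h : PolarlyPrimitive g q) (hω : IsPrimitiveRoot ω q) :
    ∀ k < (q : ℕ), ∀ l < (q : ℕ), twistHom (ω ^ k) g⁻¹ = twistHom (ω ^ l) g⁻¹ → k = l := by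
  intro k hk l hl hkl
  rw [map_inv₀, map_inv₀, inv_inj] at hkl
  have h1 : twistHom ((ω ^ k)⁻¹ * ω ^ l) g = g := by
    rw [← twistHom_twistHom, ← hkl, twistHom_twistHom, inv_mul_cancel, twistHom_one]
  by_contra hne
  have h2 : (ω ^ k)⁻¹ * ω ^ l ≠ 1 := fun h => hne (hω.pow_inj hk hl (inv_mul_eq_one.1 h))
  have hpow : ∀ j : ℕ, (ω ^ j) ^ (q : ℕ) = 1 := fun j => by
    rw [← pow_mul, mul_comm, pow_mul, hω.pow_eq_one, one_pow]
  have h3 := h.order_sub_twistHom_neg (c := (ω ^ k)⁻¹ * ω ^ l)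
    (by rw [mul_pow, inv_pow, hpow, hpow, inv_one, one_mul]) h2
  rw [h1, sub_self, order_zero] at h3
  exact lt_irrefl _ h3

/-- If `g(s^b)` and `f(c s^a)` agreed at all exponents up to 0, every polar exponent of `f` would be
divisible by `b` and every one of `g` by `a`. Primitivity forces `a = b = 1`, so `q = q'`, and a
twist followed by a gauge transformation identifies the connections. -/
theorem exists_coeff_sub_substHom_ne_zero [CharZero K] {f g : LaurentSeries K}
    {q q' a b d : ℕ+} (hq : q = b * d) (hq' : q' = a * d) (hab : Nat.Coprime a b)
    (hf : PolarlyPrimitive f q) (hg : PolarlyPrimitive g q')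
    (hiso : ¬ (elementary f q).Iso (elementary g q')) {c : Kˣ} (hc : c ^ (q : ℕ) = 1) :
    ∃ n ≤ 0, (ramHom K b g - substHom a c f).coeff n ≠ 0 := by
  by_contra! hcon
  have heq : ∀ n ≤ 0, (ramHom K b g).coeff n = (substHom a c f).coeff n := fun n hn =>
    sub_eq_zero.1 (hcon n hn)
  have hcop : IsCoprime ((a : ℕ) : ℤ) ((b : ℕ) : ℤ) := Nat.isCoprime_iff_coprime.2 hab
  have ha0 : (0 : ℤ) < ((a : ℕ) : ℤ) := by exact_mod_cast a.pos
  have hb0 : (0 : ℤ) < ((b : ℕ) : ℤ) := by exact_mod_cast b.pos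
  have hb : b = 1 := by
    by_contra hb1
    have hb1' : (b : ℕ) ≠ 1 := fun h => hb1 (PNat.eq h)
    obtain ⟨n, hn, hfn, hdvd⟩ := hf b (by have := b.pos; omega) (by rw [hq, PNat.mul_coe]; simp)
    have h1 := heq (((a : ℕ) : ℤ) * n) (by nlinarith)
    rw [substHom_apply, ramHom_coeff_mul, twistHom_coeff, ramHom_coeff_of_not_dvd] at h1
    · exact mul_ne_zero (zpow_ne_zero _ c.ne_zero) hfn h1.symm
    · exact fun h => hdvd (hcop.symm.dvd_of_dvd_mul_left h)
  have ha : a = 1 := by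
    by_contra ha1
    have ha1' : (a : ℕ) ≠ 1 := fun h => ha1 (PNat.eq h)
    obtain ⟨n, hn, hgn, hdvd⟩ := hg a (by have := a.pos; omega) (by rw [hq', PNat.mul_coe]; simp)
    have h1 := heq (((b : ℕ) : ℤ) * n) (by nlinarith)
    rw [substHom_apply, ramHom_coeff_mul, ramHom_coeff_of_not_dvd a] at h1
    · exact hgn h1
    · exact fun h => hdvd (hcop.dvd_of_dvd_mul_left h)
  subst ha hb
  obtain rfl : q = q' := by rw [hq, hq']
  refine hiso ((iso_twistHom f q c hc).trans (iso_of_coeff_eq q fun n hn => ?_))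
  have := heq n hn
  rw [substHom_apply, ramHom_one_eq, ramHom_one_eq] at this
  exact this.symm

theorem order_inv_sub_inv {u v : LaurentSeries K} (hu : u ≠ 0) (hv : v ≠ 0) (huv : u ≠ v) :
    (u⁻¹ - v⁻¹).order = (u - v).order - u.order - v.order := by
  have h1 : (u⁻¹ - v⁻¹) * (u * v) = -(u - v) := by
    field_simp
    ring
  have h2 : u⁻¹ - v⁻¹ ≠ 0 := sub_ne_zero.2 fun h => huv (inv_injective h)
  have h3 := congrArg order h1
  rw [order_mul h2 (mul_ne_zero hu hv), order_mul hu hv, order_neg] at h3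
  omega

theorem order_prod {ι : Type*} (s : Finset ι) (v : ι → LaurentSeries K) (hv : ∀ i ∈ s, v i ≠ 0) :
    (∏ i ∈ s, v i).order = ∑ i ∈ s, (v i).order := by
  classical
  induction s using Finset.induction_on with
  | empty => simp
  | insert i s hi ih =>
    rw [Finset.prod_insert hi, Finset.sum_insert hi, order_mul (hv i (by simp))
      (Finset.prod_ne_zero_iff.2 fun j hj => hv j (by simp [hj])),
      ih fun j hj => hv j (by simp [hj])]

/-- The germ is `y - 1/g(x)`, with constant term `-1/g(0) ≠ 0`. -/
theorem isUnit_curve {g : LaurentSeries K} {ω : Kˣ} (hω : IsPrimitiveRoot ω (1 : ℕ+))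
    (hg : g ≠ 0) (hg0 : g.order = 0) : IsUnit (curve g 1) := by
  obtain ⟨P, hP, -, hPR, hcoeff, -⟩ := exists_curve_polynomial hω hg hg0.le
  rw [MvPowerSeries.isUnit_iff_constantCoeff, isUnit_iff_ne_zero,
    ← MvPowerSeries.coeff_zero_eq_constantCoeff_apply, hcoeff]
  have h1 := congrArg (fun R : Polynomial (LaurentSeries K) => (R.coeff 0).coeff 0) hPR
  simp only [PNat.one_coe, Finset.range_one, Finset.prod_singleton, pow_zero, twistHom_one,
    Polynomial.coeff_map, Polynomial.coeff_sub, Polynomial.coeff_X_zero, Polynomial.coeff_C_zero,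
    zero_sub, coeff_neg] at h1
  rw [ramPowerSeries_apply, ramHom_one_eq] at h1
  have h2 := ofPowerSeries_apply_coeff (Γ := ℤ) (P.coeff 0) 0
  rw [Nat.cast_zero, h1] at h2
  rw [Finsupp.zero_apply, Finsupp.zero_apply, ← h2, neg_ne_zero]
  intro h3
  have h4 : g⁻¹.order = 0 := by rw [order_inv_eq hg, hg0, neg_zero]
  rw [← h4, coeff_order_eq_zero] at h3
  exact inv_ne_zero hg h3

theorem exists_primitiveRoot_units [IsAlgClosed K] [CharZero K] (q : ℕ+) :
    ∃ ω : Kˣ, IsPrimitiveRoot ω (q : ℕ) := by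
  have : NeZero (q : ℕ) := ⟨q.ne_zero⟩
  obtain ⟨ζ, hζ⟩ := HasEnoughRootsOfUnity.exists_primitiveRoot K (q : ℕ)
  exact ⟨(hζ.isUnit q.ne_zero).unit, IsPrimitiveRoot.coe_units_iff.1 hζ⟩

theorem exists_coprime_factors (q q' : ℕ+) :
    ∃ a b d : ℕ+, q = b * d ∧ q' = a * d ∧ Nat.Coprime a b := by
  have hd : 0 < Nat.gcd q q' := Nat.gcd_pos_of_pos_left _ q.pos
  obtain ⟨b, hb⟩ := Nat.gcd_dvd_left (q : ℕ) q'
  obtain ⟨a, ha⟩ := Nat.gcd_dvd_right (q : ℕ) q'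
  have hcop : Nat.Coprime b a := by
    have := Nat.coprime_div_gcd_div_gcd hd
    rwa [Nat.div_eq_of_eq_mul_right hd hb, Nat.div_eq_of_eq_mul_right hd ha] at this
  have hb0 : 0 < b := Nat.pos_of_ne_zero (by rintro rfl; exact q.ne_zero hb)
  have ha0 : 0 < a := Nat.pos_of_ne_zero (by rintro rfl; exact q'.ne_zero ha)
  exact ⟨⟨a, ha0⟩, ⟨b, hb0⟩, ⟨_, hd⟩, PNat.eq (hb.trans (mul_comm _ _)),
    PNat.eq (ha.trans (mul_comm _ _)), hcop.symm⟩

/-- The symmetry of the intersection algebra. -/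
def intersectionAlgebraComm (F G : MvPowerSeries (Fin 2) K) :
    IntersectionAlgebra F G ≃ₗ[K] IntersectionAlgebra G F :=
  (Ideal.quotientEquivAlgOfEq K (by rw [Set.pair_comm])).toLinearEquiv

theorem intersectionNumber_comm (F G : MvPowerSeries (Fin 2) K) :
    intersectionNumber F G = intersectionNumber G F :=
  (intersectionAlgebraComm F G).finrank_eq

/-- The parametrized germ, here that of `g`, stands first. The polynomial of `C_{f,q}` evaluated at
`1/g(u)` factors after `u = s ^ b` into the `q` differences `1/g(s^b) - 1/f(ζ^k s^a)`. -/
theorem intersectionNumber_curve_curve [CharZero K] {q q' a b d : ℕ+} (hq : q = b * d) (hq' : q' = a * d)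
    (hab : Nat.Coprime a b) {ζ ω : Kˣ} (hζ : IsPrimitiveRoot ζ (q : ℕ))
    (hω : IsPrimitiveRoot ω (q' : ℕ)) {f g : LaurentSeries K} {p p' : ℕ} (hf : f ≠ 0)
    (hfp : f.order = -(p : ℤ)) (hg : g ≠ 0) (hgp : g.order = -(p' : ℤ))
    (hfq : PolarlyPrimitive f q) (hgq : PolarlyPrimitive g q')
    (hiso : ¬ (elementary f q).Iso (elementary g q')) :
    Module.Finite K (IntersectionAlgebra (curve g q') (curve f q)) ∧
      (intersectionNumber (curve g q') (curve f q) : ℤ) = (p : ℤ) * (q' : ℕ) + (p' : ℤ) * (q : ℕ) -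
        ((∑ j : Fin d, pole (ramHom K b g - substHom a (ζ ^ (j : ℕ)) f) : ℕ) : ℤ) := by
  have hζpow : ∀ k : ℕ, (ζ ^ k) ^ (q : ℕ) = 1 := fun k => by
    rw [← pow_mul, mul_comm, pow_mul, hζ.pow_eq_one, one_pow]
  -- Without a pole, `g` has `q' = 1` and a unit germ; the formula then says that the irregularity
  -- is `p`.
  rcases Nat.eq_zero_or_pos p' with rfl | hp'
  · have hg0 : g.order = 0 := by simpa using hgp
    obtain rfl : q' = 1 := hgq.eq_one hg0.ge
    obtain ⟨h1, h2⟩ := intersectionAlgebra_of_isUnit (G := curve f q) (isUnit_curve hω hg hg0)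
    refine ⟨h1, ?_⟩
    have had : (a : ℕ) = 1 ∧ (d : ℕ) = 1 := by
      have := congrArg PNat.val hq'
      exact mul_eq_one.1 this.symm
    obtain rfl : a = 1 := PNat.eq had.1
    obtain rfl : d = 1 := PNat.eq had.2
    have h3 : ∀ c : Kˣ, pole (ramHom K b g - substHom 1 c f) = p := by
      intro c
      have h4 : pole (ramHom K b g - substHom 1 c f) = pole (-(substHom 1 c f)) := by
        refine pole_eq_of_coeff fun n hn => ?_
        rw [coeff_sub, coeff_neg, coeff_eq_zero_of_lt_order (x := ramHom K b g), zero_sub]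
        rw [order_ramHom, hg0, mul_zero]
        exact hn
      rw [h4, pole, order_neg, substHom_apply, order_ramHom, order_twistHom, hfp]
      simp
    rw [h2, Finset.sum_congr rfl fun j _ => h3 _, Finset.sum_const, Finset.card_univ,
      Fintype.card_fin]
    simp
  · obtain ⟨P, hPm, hPdeg, hPR, hPc, hPd⟩ := exists_curve_polynomial hω hg (by omega)
    obtain ⟨Q, -, -, hQR, hQc, -⟩ := exists_curve_polynomial hζ hf (by omega)
    have hg0 : g⁻¹ ∈ lattice K 0 := by
      refine lattice_mono ?_ (mem_lattice_order g⁻¹)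
      rw [order_inv_eq hg]
      omega
    have hPα : P.eval₂ (ramPowerSeries K q') g⁻¹ = 0 := by
      rw [← Polynomial.eval_map, hPR, Polynomial.eval_prod]
      refine Finset.prod_eq_zero (i := 0) (Finset.mem_range.2 q'.pos) ?_
      rw [pow_zero, twistHom_one]
      simp
    set e := Q.eval₂ (ramPowerSeries K q') g⁻¹ with he
    set w : ℕ → LaurentSeries K := fun k => substHom a (ζ ^ k) f with hw
    have hκg : ramHom K b g ≠ 0 := (map_ne_zero _).2 hg
    have hw0 : ∀ k, w k ≠ 0 := fun k => (map_ne_zero _).2 hf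
    have hne : ∀ k, ramHom K b g - w k ≠ 0 ∧ (ramHom K b g - w k).order ≤ 0 := by
      intro k
      obtain ⟨n, hn, hn'⟩ :=
        exists_coeff_sub_substHom_ne_zero hq hq' hab hfq hgq hiso (hζpow k)
      exact ⟨fun h => hn' (by rw [hw] at h; rw [h, coeff_zero]),
        (order_le_of_coeff_ne_zero hn').trans hn⟩
    have hbe : ramHom K b e = ∏ k ∈ Finset.range q, ((ramHom K b g)⁻¹ - (w k)⁻¹) := by
      have hcomp : (ramHom K b).comp (ramPowerSeries K q') =
          (ramHom K a).comp (ramPowerSeries K q) := by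
        ext1 v
        simp only [RingHom.comp_apply, ramPowerSeries_apply, ramHom_ramHom]
        rw [hq, hq', mul_left_comm]
      rw [he, Polynomial.hom_eval₂, hcomp, ← Polynomial.eval₂_map, hQR, Polynomial.eval₂_finsetProd]
      simp [hw, substHom_apply]
    have hfac : ∀ k ∈ Finset.range q, (ramHom K b g)⁻¹ - (w k)⁻¹ ≠ 0 := fun k _ =>
      sub_ne_zero.2 fun h => (hne k).1 (sub_eq_zero.2 (inv_injective h))
    have he0 : e ≠ 0 := by
      intro h
      rw [h, map_zero] at hbe
      exact Finset.prod_ne_zero_iff.2 hfac hbe.symm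
    obtain ⟨h1, h2⟩ := intersectionNumber_eq_order hω (hgq.twistHom_inv_injective hω) hg0
      (hPd (by omega)) hPdeg hPα he0 (iteratedEquiv_eq_coe hPc) (iteratedEquiv_eq_coe hQc)
    refine ⟨h1, ?_⟩
    have h3 := congrArg order hbe
    -- The order of `g(s^b) - f(ζ^k s^a)` is at most 0, so it is exactly minus the pole order;
    -- truncation at 0 loses nothing.
    have h4 : ∀ k ∈ Finset.range q, ((ramHom K b g)⁻¹ - (w k)⁻¹).order =
        ((b : ℕ) : ℤ) * p' + ((a : ℕ) : ℤ) * p - (pole (ramHom K b g - w k) : ℤ) := by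
      intro k _
      have hwo : (w k).order = ((a : ℕ) : ℤ) * -(p : ℤ) := by
        simp only [hw, substHom_apply, order_ramHom, order_twistHom, hfp]
      rw [order_inv_sub_inv hκg (hw0 k) (sub_ne_zero.1 (hne k).1), order_ramHom, hgp, hwo, pole,
        Int.toNat_of_nonneg (by have := (hne k).2; omega)]
      ring
    rw [order_ramHom, order_prod _ _ hfac, Finset.sum_congr rfl h4, Finset.sum_sub_distrib,
      Finset.sum_const, Finset.card_range, ← Nat.cast_sum, sum_pole_substHom hq hab hζ, ← h2] at h3
    -- Orders in `s` are `b` times orders in `u`, and the `q` pole orders sum to `b` times the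
    -- irregularity, so `b` cancels.
    have hb0 : ((b : ℕ) : ℤ) ≠ 0 := by exact_mod_cast b.ne_zero
    refine mul_left_cancel₀ hb0 (h3.trans ?_)
    rw [hq, hq', PNat.mul_coe, PNat.mul_coe]
    push_cast
    simp only [nsmul_eq_mul]
    push_cast
    ring

theorem intersectionNumber_curve_pderiv {q : ℕ+} {ω : Kˣ} (hω : IsPrimitiveRoot ω (q : ℕ))
    {f : LaurentSeries K} {p : ℕ} (hf : f ≠ 0) (hfp : f.order = -(p : ℤ))
    (hfq : PolarlyPrimitive f q) :
    Module.Finite K (IntersectionAlgebra (curve f q) (MvPowerSeries.pderiv K 1 (curve f q))) ∧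
      (intersectionNumber (curve f q) (MvPowerSeries.pderiv K 1 (curve f q)) : ℤ) =
        2 * (p : ℤ) * (((q : ℕ) : ℤ) - 1) -
          ((∑ j : Fin q, pole (ramHom K 1 f - substHom 1 (ω ^ (j : ℕ)) f) : ℕ) : ℤ) := by
  have hpole : ∀ c : Kˣ, ramHom K 1 f - substHom 1 c f = f - twistHom c f := fun c => by
    rw [substHom_apply, ramHom_one_eq, ramHom_one_eq]
  simp only [hpole]
  rw [← Finset.sum_range fun j => pole (f - twistHom (ω ^ j) f)]
  rcases Nat.eq_zero_or_pos p with rfl | hp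
  · have hf0 : f.order = 0 := by simpa using hfp
    obtain rfl : q = 1 := hfq.eq_one hf0.ge
    obtain ⟨h1, h2⟩ := intersectionAlgebra_of_isUnit
      (G := MvPowerSeries.pderiv K 1 (curve f 1)) (isUnit_curve hω hf hf0)
    refine ⟨h1, ?_⟩
    rw [h2]
    simp [twistHom_one, pole]
  · obtain ⟨P, hPm, hPdeg, hPR, hPc, hPd⟩ := exists_curve_polynomial hω hf (by omega)
    obtain ⟨n, hn⟩ : ∃ n, (q : ℕ) = n + 1 := ⟨q - 1, by have := q.pos; omega⟩
    have hf0 : f⁻¹ ∈ lattice K 0 := by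
      refine lattice_mono ?_ (mem_lattice_order f⁻¹)
      rw [order_inv_eq hf]
      omega
    rw [hn, Finset.prod_range_succ', pow_zero, twistHom_one] at hPR
    have hPα : P.eval₂ (ramPowerSeries K q) f⁻¹ = 0 := by
      rw [← Polynomial.eval_map, hPR]
      simp
    set e := P.derivative.eval₂ (ramPowerSeries K q) f⁻¹ with he
    have hneg : ∀ k ∈ Finset.range n, (f - twistHom (ω ^ (k + 1)) f).order < 0 := by
      intro k hk
      refine hfq.order_sub_twistHom_neg ?_ fun h => ?_
      · rw [← pow_mul, mul_comm, pow_mul, hω.pow_eq_one, one_pow]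
      · have h1 := hω.pow_inj (i := k + 1) (j := 0) (by have := Finset.mem_range.1 hk; omega)
          q.pos (by rw [h, pow_zero])
        omega
    have hne : ∀ k ∈ Finset.range n, f ≠ twistHom (ω ^ (k + 1)) f := by
      intro k hk h
      have h1 := hneg k hk
      rw [← h, sub_self, order_zero] at h1
      exact lt_irrefl _ h1
    -- In the product rule only the term that differentiates `y - 1/f` survives at `y = 1/f`.
    have heq : e = ∏ k ∈ Finset.range n, (f⁻¹ - (twistHom (ω ^ (k + 1)) f)⁻¹) := by
      rw [he, ← Polynomial.eval_map, ← Polynomial.derivative_map, hPR, Polynomial.derivative_mul,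
        Polynomial.eval_add, Polynomial.eval_mul, Polynomial.eval_mul, Polynomial.eval_prod]
      simp
    have hfac : ∀ k ∈ Finset.range n, f⁻¹ - (twistHom (ω ^ (k + 1)) f)⁻¹ ≠ 0 := fun k hk =>
      sub_ne_zero.2 fun h => hne k hk (inv_injective h)
    have he0 : e ≠ 0 := by
      rw [heq]
      exact Finset.prod_ne_zero_iff.2 hfac
    obtain ⟨h1, h2⟩ := intersectionNumber_eq_order hω (hfq.twistHom_inv_injective hω) hf0
      (hPd (by omega)) hPdeg hPα he0 (iteratedEquiv_eq_coe hPc) (iteratedEquiv_pderiv hPc)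
    refine ⟨h1, ?_⟩
    have h4 : ∀ k ∈ Finset.range n, (f⁻¹ - (twistHom (ω ^ (k + 1)) f)⁻¹).order =
        2 * (p : ℤ) - (pole (f - twistHom (ω ^ (k + 1)) f) : ℤ) := by
      intro k hk
      rw [order_inv_sub_inv hf ((map_ne_zero _).2 hf) (hne k hk), order_twistHom, hfp, pole,
        Int.toNat_of_nonneg (by have := hneg k hk; omega)]
      ring
    -- The irregularity sum has one more term than the product, that of `k = 0`, and it is the pole
    -- order of `f - f = 0`.
    rw [h2, ← he, heq, order_prod _ _ hfac, Finset.sum_congr rfl h4, Finset.sum_sub_distrib,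
      Finset.sum_const, Finset.card_range, hn, Finset.sum_range_succ', pow_zero, twistHom_one,
      sub_self]
    simp [pole]
    ring

end FormalConnection

end

/-! ### The main theorem -/

open FormalConnection in
theorem mainTheorem2 {K : Type*} [Field K] [IsAlgClosed K] [CharZero K]
    (q : ℕ+) (p : ℕ) (f : LaurentSeries K) (hf : f ≠ 0) (hfp : f.order = -(p : ℤ))
    (hirr : (elementary f q).IsIrreducible) :
    (∀ (q' : ℕ+) (p' : ℕ) (g : LaurentSeries K), g ≠ 0 → g.order = -(p' : ℤ) →
      (elementary g q').IsIrreducible →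
      ¬ (elementary f q).Iso (elementary g q') →
        (∃! r : ℕ, HasIrregularity ((elementary f q).hom (elementary g q')) r) ∧
        Module.Finite K (IntersectionAlgebra (curve f q) (curve g q')) ∧
        (intersectionNumber (curve f q) (curve g q') : ℤ) =
          (p : ℤ) * (q' : ℕ) + (p' : ℤ) * (q : ℕ) -
            (irr ((elementary f q).hom (elementary g q')) : ℤ)) ∧
    ((∃! r : ℕ, HasIrregularity ((elementary f q).hom (elementary f q)) r) ∧
      Module.Finite K
        (IntersectionAlgebra (curve f q) (MvPowerSeries.pderiv K 1 (curve f q))) ∧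
      (intersectionNumber (curve f q) (MvPowerSeries.pderiv K 1 (curve f q)) : ℤ) =
        2 * (p : ℤ) * (((q : ℕ) : ℤ) - 1) -
          (irr ((elementary f q).hom (elementary f q)) : ℤ)) := by
  have hfq := IsIrreducible.polarlyPrimitive hirr
  obtain ⟨ζ, hζ⟩ := exists_primitiveRoot_units (K := K) q
  refine ⟨fun q' p' g hg hgp hirr' hiso => ?_, ?_⟩
  · obtain ⟨ω, hω⟩ := exists_primitiveRoot_units (K := K) q'
    obtain ⟨a, b, d, hq, hq', hab⟩ := exists_coprime_factors q q'
    have hI := (hasElementaryDecomposition_hom hq hq' hab hζ f g).hasIrregularity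
    have hC := intersectionNumber_curve_curve hq hq' hab hζ hω hf hfp hg hgp hfq
      (IsIrreducible.polarlyPrimitive hirr') hiso
    rw [hI.irr_eq]
    have := hC.1
    exact ⟨hI.existsUnique, Module.Finite.equiv (intersectionAlgebraComm (curve g q') (curve f q)),
      (congrArg Nat.cast (intersectionNumber_comm _ _)).trans hC.2⟩
  -- For endomorphisms `a = b = 1` and `d = q`.
  · have hI := (hasElementaryDecomposition_hom (one_mul q).symm (one_mul q).symm
      (Nat.coprime_one_left 1) hζ f f).hasIrregularity
    rw [hI.irr_eq]
    exact ⟨hI.existsUnique, intersectionNumber_curve_pderiv hζ hf hfp hfq⟩
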